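/- Let $F$ be an infinite field, $K\supseteq F$ an algebraically closed field, and let $A$ be an affine (finitely generated) $F$-algebra, not necessarily with $1$, that is representable: $A$ is embedded as an $F$-subalgebra in a matrix algebra $M_N(K)$ (in particular $A$ is a PI-algebra). Let $\hat A\subseteq M_N(K)$ be the closure of $A$ in the Zariski topology of $M_N(K)$; it is a $K$-subalgebra. Let $J$ be the Jacobson radical of $\hat A$. Then there are an algebraically closed field $L\supseteq K$ and a faithful representation $\rho:\hat A\to M_n(L)$ (a $K$-algebra homomorphism) in Wedderburn block form, for whose full quiver all polynomial relations of $\rho(\hat A)$ are consequences of (identical diagonal and) proportional gluing. Here: (a) *Wedderburn block form* means: $\hat A=S\oplus J$ with a subalgebra $S\cong A_1\times\dots\times A_k$, $A_u\cong M_{n_u}(K)$; the matrices of $M_n(L)$ are divided into blocks by an ordered list of diagonal blocks $r=1,\dots,\ell$, each of which either is labelled by some $u\in\{1,\dots,k\}$ and has size $n_u\times n_u$, or is a zero block (of size $1\times1$, a larger zero block being listed as several such blocks; zero blocks occur only if $\hat A$ has no $1$), and every $u$ occurs as a label; $\rho(S)$ is block diagonal, it vanishes on the zero blocks, and projection to a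 block labelled $u$ kills the $A_v$ with $v\neq u$ and is injective on $A_u$; and $\rho(J)$ lies in the strictly upper triangular blocks. Diagonal blocks with the same label are called glued. (b) The *full quiver* of $\rho$ has the diagonal blocks as vertices, and an arrow $r\to s$ ($r\ne s$) iff the $(r,s)$ block of $\rho(\hat A)$ is nonzero. Arrows $r\to s$ and $r'\to s'$, with $r,r'$ glued (or both zero blocks) and $s,s'$ glued (or both zero blocks), are *proportionally glued* with factor $\nu\in L$ if for all $a\in\hat A$ the $(r',s')$ block of $\rho(a)$ equals $\nu$ times its $(r,s)$ block. (c) The conclusion about polynomial relations is: the ideal of all polynomials in the $n^2$ matrix entries $\lambda_{ij}$, with coefficients in $L$, that vanish on $\rho(\hat A)$ is generated by the following linear relations: the entries below the diagonal blocks, those in zero diagonal blocks, and those in blocks above the diagonal without an arrow are $0$; glued diagonal blocks are identical; and, for each pair of arrows proportionally glued with factor $\nu$, the entries of the one block are $\nu$ times the respective entries of the other. -/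

import Mathlib

universe u

noncomputable section

/-- The coordinates (matrix entries) of a matrix, as a point of affine space. -/
def matrixEntries {I K : Type*} (x : Matrix I I K) : I × I → K := fun p => x p.1 p.2

/-- The ideal of polynomial relations of a set of matrices: all polynomials in the matrix
entries `λ_{ij}` that vanish at every matrix of the set. -/
def polynomialRelations {I K : Type*} [Field K] (s : Set (Matrix I I K)) :
    Ideal (MvPolynomial (I × I) K) :=
  MvPolynomial.vanishingIdeal K (matrixEntries '' s)

/-- The closure of a set of matrices in the Zariski topology of `M_n(K)`. -/
def zariskiClosureSet {I K : Type*} [Field K] (s : Set (Matrix I I K)) :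
    Set (Matrix I I K) :=
  {x | matrixEntries x ∈ MvPolynomial.zeroLocus K (polynomialRelations s)}

theorem mem_zariskiClosureSet {I K : Type*} [Field K] {s : Set (Matrix I I K)}
    {x : Matrix I I K} :
    x ∈ zariskiClosureSet s ↔ ∀ p : MvPolynomial (I × I) K,
      (∀ a ∈ s, MvPolynomial.aeval (matrixEntries a) p = 0) →
        MvPolynomial.aeval (matrixEntries x) p = 0 := by
  simp [zariskiClosureSet, polynomialRelations]

theorem subset_zariskiClosureSet {I K : Type*} [Field K] (s : Set (Matrix I I K)) :
    s ⊆ zariskiClosureSet s :=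
  fun a ha => mem_zariskiClosureSet.2 fun _ hp => hp a ha

/-- Zariski closure and polynomial maps: if a polynomial self-map sends `s` into the closure
of `t`, then it sends the closure of `s` into the closure of `t`. -/
theorem zariskiClosureSet_of_polynomialMap {I K : Type*} [Field K] {s t : Set (Matrix I I K)}
    (f : I × I → MvPolynomial (I × I) K) (g : Matrix I I K → Matrix I I K)
    (hg : ∀ x, matrixEntries (g x) = fun i => MvPolynomial.aeval (matrixEntries x) (f i))
    (hs : ∀ a ∈ s, g a ∈ zariskiClosureSet t) {x : Matrix I I K}
    (hx : x ∈ zariskiClosureSet s) : g x ∈ zariskiClosureSet t := by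
  rw [mem_zariskiClosureSet] at hx ⊢
  intro p hp
  have key : ∀ y, MvPolynomial.aeval (matrixEntries (g y)) p =
      MvPolynomial.aeval (matrixEntries y) (MvPolynomial.bind₁ f p) := by
    intro y
    rw [hg, MvPolynomial.aeval_bind₁]
  rw [key]
  refine hx _ fun a ha => ?_
  rw [← key]
  exact mem_zariskiClosureSet.1 (hs a ha) p hp

/-- The Zariski closure in `M_n(K)` of an `F`-subalgebra (not necessarily containing `1`), where
`F` is an infinite subfield of `K`. It is a `K`-subalgebra. -/
def zariskiClosure {F K I : Type*} [Field F] [Infinite F] [Field K] [Algebra F K] [Fintype I]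
    (A : NonUnitalSubalgebra F (Matrix I I K)) : NonUnitalSubalgebra K (Matrix I I K) where
  carrier := zariskiClosureSet (A : Set (Matrix I I K))
  zero_mem' := subset_zariskiClosureSet _ A.zero_mem
  add_mem' := by
    intro x y hx hy
    have h1 : ∀ a ∈ A, y + a ∈ zariskiClosureSet (A : Set (Matrix I I K)) := by
      intro a ha
      refine zariskiClosureSet_of_polynomialMap
        (fun i => MvPolynomial.X i + MvPolynomial.C (matrixEntries a i)) (fun z => z + a) ?_ ?_ hy
      · intro z; ext i; simp [matrixEntries]
      · intro b hb; exact subset_zariskiClosureSet _ (A.add_mem hb ha)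
    refine zariskiClosureSet_of_polynomialMap
      (fun i => MvPolynomial.X i + MvPolynomial.C (matrixEntries y i)) (fun z => z + y) ?_ ?_ hx
    · intro z; ext i; simp [matrixEntries]
    · intro b hb
      have := h1 b hb
      rwa [add_comm] at this
  mul_mem' := by
    intro x y hx hy
    have h1 : ∀ a ∈ A, a * y ∈ zariskiClosureSet (A : Set (Matrix I I K)) := by
      intro a ha
      refine zariskiClosureSet_of_polynomialMap
        (fun i => ∑ k, MvPolynomial.C (a i.1 k) * MvPolynomial.X (k, i.2))
        (fun z => a * z) ?_ ?_ hy
      · intro z; ext i; simp [matrixEntries, Matrix.mul_apply]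
      · intro b hb; exact subset_zariskiClosureSet _ (A.mul_mem ha hb)
    refine zariskiClosureSet_of_polynomialMap
      (fun i => ∑ k, MvPolynomial.X (i.1, k) * MvPolynomial.C (y k i.2))
      (fun z => z * y) ?_ h1 hx
    intro z; ext i; simp [matrixEntries, Matrix.mul_apply]
  smul_mem' := by
    intro c x hx
    have h1 : ∀ a ∈ A, c • a ∈ zariskiClosureSet (A : Set (Matrix I I K)) := by
      intro a ha
      rw [mem_zariskiClosureSet]
      intro p hp
      let q : Polynomial K :=
        MvPolynomial.aeval (fun i => Polynomial.X * Polynomial.C (matrixEntries a i)) p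
      have hq : ∀ t : K, q.eval t = MvPolynomial.aeval (matrixEntries (t • a)) p := by
        intro t
        have h2 : (Polynomial.aeval t) q = MvPolynomial.aeval (matrixEntries (t • a)) p := by
          change (Polynomial.aeval t) (MvPolynomial.aeval _ p) = _
          rw [← AlgHom.restrictScalars_apply K (Polynomial.aeval t : Polynomial K →ₐ[K] K),
            ← AlgHom.comp_apply]
          congr 1
          ext i
          simp [matrixEntries, mul_comm t]
        rw [← h2, Polynomial.coe_aeval_eq_eval]
      have hq0 : q = 0 := by
        refine Polynomial.eq_zero_of_infinite_isRoot q ?_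
        refine (Set.infinite_range_of_injective
          (FaithfulSMul.algebraMap_injective F K)).mono ?_
        rintro _ ⟨t, rfl⟩
        change q.eval _ = 0
        rw [hq, algebraMap_smul]
        exact hp _ (A.smul_mem' t ha)
      rw [← hq, hq0, Polynomial.eval_zero]
    refine zariskiClosureSet_of_polynomialMap
      (fun i => MvPolynomial.C c * MvPolynomial.X i) (fun z => c • z) ?_ h1 hx
    intro z; ext i; simp [matrixEntries]

/-- The Jacobson radical of a `K`-algebra `B` that need not contain `1`: the intersection of `B`
with the Jacobson radical of `K ⊕ B` (the algebra with `1` adjoined). For `B` with `1` this is the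
usual Jacobson radical. -/
def algebraRadical (K B : Type*) [Field K] [NonUnitalRing B] [Module K B] [IsScalarTower K B B]
    [SMulCommClass K B B] : Submodule K B :=
  (Submodule.restrictScalars K (Ring.jacobson (Unitization K B))).comap
    (Unitization.inrHom K K B)

/-- The labelled vertices of a full quiver. There are `numVertices` vertices, one for each
diagonal block, in order. There are `numComponents` glued components of vertices; the vertices of
component `u` have matrix degree `deg u`. The label of a vertex is its glued component, or `none`
for a vertex `∘` belonging to a zero diagonal block. A zero diagonal block of size `d` is listed as
`d` zero blocks of size one. -/
structure QuiverVertices where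
  numComponents : ℕ
  deg : Fin numComponents → ℕ
  deg_pos : ∀ u, 0 < deg u
  numVertices : ℕ
  label : Fin numVertices → Option (Fin numComponents)
  exists_label : ∀ u, ∃ r, label r = some u

namespace QuiverVertices

/-- The size of the diagonal blocks with a given label. -/
def size (P : QuiverVertices) : Option (Fin P.numComponents) → ℕ
  | some u => P.deg u
  | none => 1

/-- The row and column indices of the matrices: pairs of a vertex `r` and a position inside the
`r`-th block. -/
abbrev Idx (P : QuiverVertices) : Type := Σ r : Fin P.numVertices, Fin (P.size (P.label r))

/-- The same position in another block with the same label. -/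
def samePos (P : QuiverVertices) {r r' : Fin P.numVertices} (h : P.label r = P.label r')
    (i : Fin (P.size (P.label r))) : Fin (P.size (P.label r')) :=
  Fin.cast (congrArg P.size h) i

/-- The `(r, s)` block of a matrix. -/
def block (P : QuiverVertices) {L : Type*} (M : Matrix P.Idx P.Idx L) (r s : Fin P.numVertices) :
    Matrix (Fin (P.size (P.label r))) (Fin (P.size (P.label s))) L :=
  Matrix.of fun i j => M ⟨r, i⟩ ⟨s, j⟩

end QuiverVertices

section Representation

variable {K L B : Type*} [Field K] [Field L] [Algebra K L] [NonUnitalRing B] [Module K B]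
  [IsScalarTower K B B] [SMulCommClass K B B]

/-- A representation `ρ : B → M_n(L)` is in Wedderburn block form (with diagonal blocks as listed
in `P`): `B = S ⊕ J` with `J` the radical and `S` a subalgebra isomorphic to
`A_1 × ⋯ × A_k = M_{n_1}(K) × ⋯ × M_{n_k}(K)`; `ρ(S)` is block diagonal, and the diagonal block of
a vertex labelled `u` is an isomorphic copy of `A_u` under the projection; `ρ` maps `J` into the
strictly upper triangular blocks. Zero diagonal blocks are only allowed if `B` has no `1`. -/
structure IsWedderburnBlockForm (P : QuiverVertices) (ρ : B →ₙₐ[K] Matrix P.Idx P.Idx L) :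
    Prop where
  semisimple_part : ∃ σ : (∀ u, Matrix (Fin (P.deg u)) (Fin (P.deg u)) K) →ₙₐ[K] B,
    Function.Injective σ ∧
    IsCompl (NonUnitalAlgHom.range σ).toSubmodule (algebraRadical K B) ∧
    (∀ x r s, r ≠ s → P.block (ρ (σ x)) r s = 0) ∧
    (∀ x r, P.label r = none → P.block (ρ (σ x)) r r = 0) ∧
    (∀ x r u, P.label r = some u → (P.block (ρ (σ x)) r r = 0 ↔ x u = 0))
  radical_part : ∀ x ∈ algebraRadical K B, ∀ r s, s ≤ r → P.block (ρ x) r s = 0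
  zero_block : (∃ e : B, ∀ x, e * x = x ∧ x * e = x) → ∀ r, P.label r ≠ none

/-- The full quiver of a representation: a directed graph on the diagonal blocks, with an arrow
from `r` to `s ≠ r` iff `e_r ρ(B) e_s ≠ 0`. -/
def fullQuiver (P : QuiverVertices) (ρ : B →ₙₐ[K] Matrix P.Idx P.Idx L) :
    Digraph (Fin P.numVertices) where
  Adj r s := r ≠ s ∧ ∃ b, P.block (ρ b) r s ≠ 0

/-- Two arrows `r → s` and `r' → s'` of the full quiver, whose initial vertices are glued (or both
`∘`) and whose terminal vertices are glued (or both `∘`), are proportionally glued with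
proportionality factor `ν`: throughout `ρ(B)`, the entries of the `(r', s')` block are `ν` times the
respective entries of the `(r, s)` block. -/
def ProportionallyGlued (P : QuiverVertices) (ρ : B →ₙₐ[K] Matrix P.Idx P.Idx L)
    {r s r' s' : Fin P.numVertices} (hr : P.label r = P.label r') (hs : P.label s = P.label s')
    (ν : L) : Prop :=
  (fullQuiver P ρ).Adj r s ∧ (fullQuiver P ρ).Adj r' s' ∧
    ∀ b i j, P.block (ρ b) r' s' (P.samePos hr i) (P.samePos hs j) = ν * P.block (ρ b) r s i j

open MvPolynomial in
/-- The relations that are read off from the full quiver with its proportional gluing. -/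
inductive IsGluingRelation (P : QuiverVertices) (ρ : B →ₙₐ[K] Matrix P.Idx P.Idx L) :
    MvPolynomial (P.Idx × P.Idx) L → Prop
  /-- The entries below the diagonal blocks are `0`. -/
  | below_diagonal (r s : Fin P.numVertices) (h : s < r) (i j) :
      IsGluingRelation P ρ (X (⟨r, i⟩, ⟨s, j⟩))
  /-- The entries of a zero diagonal block are `0`. -/
  | zero_block (r : Fin P.numVertices) (h : P.label r = none) (i j) :
      IsGluingRelation P ρ (X (⟨r, i⟩, ⟨r, j⟩))
  /-- Glued diagonal blocks are identical. -/
  | diagonal (r r' : Fin P.numVertices) (h : P.label r = P.label r') (i j) :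
      IsGluingRelation P ρ
        (X (⟨r', P.samePos h i⟩, ⟨r', P.samePos h j⟩) - X (⟨r, i⟩, ⟨r, j⟩))
  /-- The blocks above the diagonal that do not belong to an arrow are `0`. -/
  | no_arrow (r s : Fin P.numVertices) (hrs : r < s) (h : ¬ (fullQuiver P ρ).Adj r s) (i j) :
      IsGluingRelation P ρ (X (⟨r, i⟩, ⟨s, j⟩))
  /-- Proportional gluing of arrows. -/
  | proportional {r s r' s' : Fin P.numVertices} (hr : P.label r = P.label r')
      (hs : P.label s = P.label s') (ν : L) (h : ProportionallyGlued P ρ hr hs ν) (i j) :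
      IsGluingRelation P ρ
        (X (⟨r', P.samePos hr i⟩, ⟨s', P.samePos hs j⟩) - C ν * X (⟨r, i⟩, ⟨s, j⟩))

end Representation

end

/-!
The closure `B` of `A` is a finite-dimensional algebra over the algebraically closed field `K`, and
the representation can be found over `L = K`.

Let `R` be `B` with `1` adjoined and `J` its radical. Lifting the matrix units of
`R / J ≅ ∏ M_{n_u}(K)` gives elements `p_{u,a} ∈ e_u R`, `q_{u,a} ∈ R e_u` with
`p_{u,a} q_{v,b} = δ e_u` and `∑ q_{u,a} p_{u,a} = 1`; one factor, of size one, belongs to the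
augmentation `R → K` and gets the label `none`. The Peirce components `e_u J e_v` have a common
basis `X_i : tgt i ← src i` which refines the powers of `J`, so that
`X_i X_j = ∑ c_{ijk} X_k` with `k < i` and `k < j`. With `ξ_i` dual to `X_i`, an element `z` is
determined by the matrices `y_u(z)` (its images in the simple factors) and
`x_i(z) = (ξ_i(p_{tgt i,a} z q_{src i,b}))_{a,b}`, all of them can be prescribed, and `x_k(z z')`
equals `y x_k + x_k y + ∑ c_{ijk} x_i(z) x_j(z')` (`exists_blockCoordinates`).

It is therefore enough to represent the structure constants `c` by strictly upper triangular
matrices `T_i` such that at each position at most one `T_i` is nonzero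
(`LabelledConstants.exists_monomial_representation`): putting `y_u` on the diagonal and
`(T_i)_{rs} x_i` into the block `(r, s)` gives a faithful representation in Wedderburn block form,
in which every arrow carries a multiple of a single `x_i`. The coordinates `y_u`, `x_i` being
independent, all polynomial relations come from equal or proportional blocks
(`BlockCoordinates.polynomialRelations_representation`).

The matrices `T_i` describe a module over the span of the `X_i` which has a basis of vertices `v`
such that the vectors `X_i v`, for varying `i`, have pairwise disjoint supports. Such vertices are
adjoined freely: for a homomorphism `φ` from the algebra to the module already present with
disjointly supported values `φ(X_i)`, there is a new vertex `v` with `X_i v = φ(X_i)`, in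
infinitely many copies. The key point (`LabelledConstants.mem_closure_splitHom`) is that every
homomorphism `φ` is a sum of disjointly supported ones. By induction on the basis, `φ` is such a sum
on `X_0, …, X_{m-1}`. Each summand `χ` extends to `X_m` once there is a vector `w` with
`X_i w = ∑ c_{imk} χ(X_k)`. The right-hand side is a homomorphism that vanishes on more basis
elements than `χ` does, hence is a sum of disjointly supported ones, and `w` is the sum of the
corresponding vertices, in copies outside of the support of `χ`. The difference between `φ` and the
sum of the extensions lives on `X_m` alone, so it is disjointly supported for trivial reasons.
-/

noncomputable section

/-! ### Formal vertices -/

/-- The basis vectors of a universal module over structure constants with basis `X_0, …, X_{d-1}`.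
A vertex carries a label, a tag whose only purpose is to provide infinitely many copies, and the
finitely many vertices (`child`) and coefficients (`coef`) in terms of which the vectors `X_i v` are
expressed. -/
inductive FormalVertex (K Λ : Type*) (d : ℕ) : Type _
  | mk (lab : Λ) (tag : ℕ) (m : ℕ) (child : Fin m → FormalVertex K Λ d) (coef : Fin d → Fin m → K) :
      FormalVertex K Λ d

namespace FormalVertex

variable {K Λ : Type*} {d : ℕ}

/-- The label of a vertex. -/
def lab : FormalVertex K Λ d → Λ
  | mk l _ _ _ _ => l

/-- The tag that distinguishes copies of a vertex. -/
def tag : FormalVertex K Λ d → ℕ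
  | mk _ t _ _ _ => t

/-- The height of the tree below a vertex. Ordering vertices by height makes the action strictly
upper triangular. -/
def height : FormalVertex K Λ d → ℕ
  | mk _ _ _ child _ => Finset.univ.sup (fun p => (child p).height + 1)

variable [Field K]

/-- The vector `X_i v`. -/
def act (i : Fin d) : FormalVertex K Λ d → (FormalVertex K Λ d →₀ K)
  | mk _ _ _ child coef => ∑ p, Finsupp.single (child p) (coef i p)

/-- The action of `X_i` on formal combinations of vertices. -/
def actL (i : Fin d) : (FormalVertex K Λ d →₀ K) →ₗ[K] (FormalVertex K Λ d →₀ K) :=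
  Finsupp.linearCombination K (act i)

@[simp] theorem actL_single (i : Fin d) (v : FormalVertex K Λ d) (a : K) :
    actL i (Finsupp.single v a) = a • act i v := by
  simp [actL]

theorem height_lt_of_mem_support {i : Fin d} {v w : FormalVertex K Λ d}
    (h : w ∈ (act i v).support) : w.height < v.height := by
  classical
  cases v with
  | mk l t m child coef =>
    obtain ⟨p, -, hp⟩ := Finset.mem_biUnion.1 (Finsupp.support_finsetSum h)
    have hw : w = child p := by
      simpa using Finsupp.support_single_subset hp
    subst hw
    rw [height]
    exact Nat.lt_of_succ_le
      (Finset.le_sup (f := fun p => (child p).height + 1) (Finset.mem_univ p))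

/-- Arbitrary values of `X_i v` are realized by a vertex `v` with given label and tag. -/
theorem exists_act_eq (l : Λ) (t : ℕ) (φ : Fin d → FormalVertex K Λ d →₀ K) :
    ∃ v : FormalVertex K Λ d, v.lab = l ∧ v.tag = t ∧ ∀ i, act i v = φ i := by
  classical
  let s : Finset (FormalVertex K Λ d) := Finset.univ.biUnion fun i => (φ i).support
  let e := s.equivFin
  refine ⟨mk l t s.card (fun p => (e.symm p : FormalVertex K Λ d)) (fun i p => φ i (e.symm p)),
    rfl, rfl, fun i => ?_⟩
  rw [act, e.symm.sum_comp (fun x : s => Finsupp.single (x : FormalVertex K Λ d) (φ i x)),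
    Finset.sum_coe_sort s (fun x => Finsupp.single x (φ i x))]
  exact (Finsupp.sum_of_support_subset (φ i)
    (Finset.subset_biUnion_of_mem (fun i => (φ i).support) (Finset.mem_univ i))
    (fun x a => Finsupp.single x a) (by simp)).symm.trans (Finsupp.sum_single _)

end FormalVertex

theorem Finset.exists_equiv_fin_of_height {α : Type*} (s : Finset α) (h : α → ℕ) :
    ∃ e : Fin s.card ≃ s, ∀ a b, h (e a) < h (e b) → a < b := by
  classical
  let key : s → ℕ ×ₗ Fin s.card := fun x => toLex (h x, s.equivFin x)
  have hinj : Function.Injective key := by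
    intro x y hxy
    have := congrArg (fun z => (ofLex z).2) hxy
    exact s.equivFin.injective this
  let _ : LinearOrder s := LinearOrder.lift' key hinj
  let e : Fin s.card ≃o s := Fintype.orderIsoFinOfCardEq s (by simp)
  refine ⟨e.toEquiv, fun a b hab => ?_⟩
  rw [← e.lt_iff_lt]
  change key (e a) < key (e b)
  rw [Prod.Lex.lt_iff]
  exact Or.inl hab

/-! ### Splitting homomorphisms into disjointly supported ones -/

/-- Structure constants `X_i X_j = ∑ c_{ijk} X_k` of an associative algebra whose basis elements
`X_i` are arrows from `src i` to `tgt i` between labels (composed like maps, `X_j` first), and which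
is nilpotent in a triangular way: only `X_k` with `k < i` and `k < j` occur in `X_i X_j`. -/
structure LabelledConstants (K Λ : Type*) [Field K] (d : ℕ) where
  tgt : Fin d → Λ
  src : Fin d → Λ
  c : Fin d → Fin d → Fin d → K
  lt_left : ∀ {i j k}, c i j k ≠ 0 → k < i
  lt_right : ∀ {i j k}, c i j k ≠ 0 → k < j
  src_eq_tgt : ∀ {i j k}, c i j k ≠ 0 → src i = tgt j
  tgt_eq : ∀ {i j k}, c i j k ≠ 0 → tgt k = tgt i
  src_eq : ∀ {i j k}, c i j k ≠ 0 → src k = src j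
  assoc : ∀ i j m k, ∑ l, c i j l * c l m k = ∑ l, c j m l * c i l k

namespace LabelledConstants

open FormalVertex

variable {K Λ : Type*} [Field K] {d : ℕ} (D : LabelledConstants K Λ d)

/-- The vertices at which the action satisfies the relations `X_i X_j = ∑ c_{ijk} X_k`, respects the
labels, and has disjointly supported values `X_i v`, hereditarily. -/
inductive IsGood : FormalVertex K Λ d → Prop
  | intro (v : FormalVertex K Λ d)
      (good : ∀ i, ∀ w ∈ (act i v).support, IsGood w)
      (tgt : ∀ i, ∀ w ∈ (act i v).support, w.lab = D.tgt i)
      (src : ∀ i, act i v ≠ 0 → v.lab = D.src i)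
      (disj : ∀ i j, i ≠ j → Disjoint (act i v).support (act j v).support)
      (mul : ∀ i j, actL i (act j v) = ∑ k, D.c i j k • act k v) : IsGood v

/-- The span of the good vertices with label `l`. -/
def goodSpan (l : Λ) : Submodule K (FormalVertex K Λ d →₀ K) :=
  Finsupp.supported K K {v | D.IsGood v ∧ v.lab = l}

/-- Homomorphisms `φ`, given by the values `φ i` at `X_i`, from the span of `X_0, …, X_{m-1}` (a left
ideal) to the span of the good vertices, that vanish at `X_i` for `i < q`, and at all `X_i` with
source different from `l`. For `i ≥ m` the value `φ i` is the junk value `0`. -/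
def partialHom (q m : ℕ) (l : Λ) : Submodule K (Fin d → FormalVertex K Λ d →₀ K) where
  carrier := {φ | (∀ i, φ i ∈ D.goodSpan (D.tgt i)) ∧ (∀ i, D.src i ≠ l → φ i = 0) ∧
    (∀ i : Fin d, (i : ℕ) < q → φ i = 0) ∧ (∀ i : Fin d, m ≤ (i : ℕ) → φ i = 0) ∧
    ∀ i j : Fin d, (j : ℕ) < m → actL i (φ j) = ∑ k, D.c i j k • φ k}
  zero_mem' := by simp
  add_mem' := by
    rintro φ ψ ⟨h1, h2, h3, h4, h5⟩ ⟨g1, g2, g3, g4, g5⟩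
    refine ⟨fun i => add_mem (h1 i) (g1 i), fun i hi => ?_, fun i hi => ?_, fun i hi => ?_,
      fun i j hj => ?_⟩
    · simp [h2 i hi, g2 i hi]
    · simp [h3 i hi, g3 i hi]
    · simp [h4 i hi, g4 i hi]
    · simp [h5 i j hj, g5 i j hj, Finset.sum_add_distrib]
  smul_mem' := by
    rintro a φ ⟨h1, h2, h3, h4, h5⟩
    refine ⟨fun i => Submodule.smul_mem _ a (h1 i), fun i hi => ?_, fun i hi => ?_,
      fun i hi => ?_, fun i j hj => ?_⟩
    · simp [h2 i hi]
    · simp [h3 i hi]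
    · simp [h4 i hi]
    · simp [h5 i j hj, Finset.smul_sum, smul_comm a]

/-- The homomorphisms whose values at the basis elements have disjoint supports. -/
def splitHom (q m : ℕ) (l : Λ) : Set (Fin d → FormalVertex K Λ d →₀ K) :=
  {φ | φ ∈ D.partialHom q m l ∧ ∀ i j, i ≠ j → Disjoint (φ i).support (φ j).support}

theorem closure_splitHom_le (q m : ℕ) (l : Λ) :
    AddSubmonoid.closure (D.splitHom q m l) ≤ (D.partialHom q m l).toAddSubmonoid :=
  AddSubmonoid.closure_le.2 fun _ h => h.1

/-- Disjointly supported homomorphisms are evaluations at good vertices, in infinitely many copies. -/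
theorem exists_good_vertex {q : ℕ} {l : Λ} {φ : Fin d → FormalVertex K Λ d →₀ K}
    (hφ : φ ∈ D.splitHom q d l) (s : Finset (FormalVertex K Λ d)) :
    ∃ v, D.IsGood v ∧ v.lab = l ∧ v ∉ s ∧ ∀ i, act i v = φ i := by
  obtain ⟨⟨h1, h2, -, -, h5⟩, hd⟩ := hφ
  obtain ⟨t, ht⟩ := Infinite.exists_notMem_finset (s.image FormalVertex.tag)
  obtain ⟨v, hl, htag, hv⟩ := exists_act_eq l t φ
  refine ⟨v, ⟨v, fun i w hw => ?_, fun i w hw => ?_, fun i hi => ?_, fun i j hij => ?_,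
    fun i j => ?_⟩, hl, fun hs => ht ?_, hv⟩
  · rw [hv] at hw
    exact ((Finsupp.mem_supported K _).1 (h1 i) hw).1
  · rw [hv] at hw
    exact ((Finsupp.mem_supported K _).1 (h1 i) hw).2
  · rw [hv] at hi
    by_contra hne
    exact hi (h2 i fun h => hne (hl.trans h.symm))
  · rw [hv, hv]
    exact hd i j hij
  · simp only [hv]
    exact h5 i j j.2
  · rw [← htag]
    exact Finset.mem_image_of_mem _ hs

/-- A sum of disjointly supported homomorphisms is the evaluation at a vector, which can be chosen
outside of a given finite set of vertices. -/
theorem exists_act_eq_of_mem_closure {q : ℕ} {l : Λ} {φ : Fin d → FormalVertex K Λ d →₀ K}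
    (hφ : φ ∈ AddSubmonoid.closure (D.splitHom q d l)) (s : Finset (FormalVertex K Λ d)) :
    ∃ w ∈ D.goodSpan l, Disjoint w.support s ∧ ∀ i, actL i w = φ i := by
  classical
  induction hφ using AddSubmonoid.closure_induction with
  | mem φ h =>
    obtain ⟨v, hg, hl, hs, hv⟩ := D.exists_good_vertex h s
    refine ⟨Finsupp.single v 1, Finsupp.single_mem_supported K _ ⟨hg, hl⟩, ?_, fun i => ?_⟩
    · refine Finset.disjoint_of_subset_left Finsupp.support_single_subset ?_
      simpa using hs
    · simp [hv]
  | zero => exact ⟨0, zero_mem _, by simp, by simp⟩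
  | add φ ψ _ _ h1 h2 =>
    obtain ⟨w, hw, hws, hwa⟩ := h1
    obtain ⟨w', hw', hws', hwa'⟩ := h2
    refine ⟨w + w', add_mem hw hw', ?_, fun i => by simp [hwa, hwa']⟩
    refine Finset.disjoint_of_subset_left Finsupp.support_add ?_
    rw [Finset.disjoint_union_left]
    exact ⟨hws, hws'⟩

/-- Extension of a homomorphism to one more basis element. The value `w` at `X_m` has to satisfy
`X_i w = ∑ c_{imk} φ(X_k)`, and the right-hand side, as a function of `X_i`, is a homomorphism that
vanishes for `i < q + 1`. -/
theorem exists_update_mem_partialHom {q m : ℕ} {l : Λ} {φ : Fin d → FormalVertex K Λ d →₀ K}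
    (H : ∀ l, ∀ ψ ∈ D.partialHom (q + 1) d l,
      ψ ∈ AddSubmonoid.closure (D.splitHom (q + 1) d l))
    (hm : m < d) (hφ : φ ∈ D.partialHom q m l) (s : Finset (FormalVertex K Λ d)) :
    ∃ w, Disjoint w.support s ∧
      Function.update φ ⟨m, hm⟩ w ∈ D.partialHom q (m + 1) l := by
  obtain ⟨h1, h2, h3, h4, h5⟩ := hφ
  set M : Fin d := ⟨m, hm⟩ with hM
  -- it is enough to solve the equations at the new index
  suffices key : ∃ w ∈ D.goodSpan (D.tgt M), Disjoint w.support s ∧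
      (D.src M ≠ l ∨ m < q → w = 0) ∧ ∀ i, actL i w = ∑ k, D.c i M k • φ k by
    obtain ⟨w, hw, hs, hz, ha⟩ := key
    have hcongr : ∀ i j : Fin d, (j : ℕ) ≤ m →
        ∑ k, D.c i j k • Function.update φ M w k = ∑ k, D.c i j k • φ k := by
      intro i j hj
      refine Finset.sum_congr rfl fun k _ => ?_
      by_cases hk : k = M
      · have : D.c i j k = 0 := by
          by_contra hne
          have := D.lt_right hne
          rw [hk, Fin.lt_def] at this
          simp only [hM] at this
          omega
        simp [this]
      · rw [Function.update_of_ne hk]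
    refine ⟨w, hs, fun i => ?_, fun i hi => ?_, fun i hi => ?_, fun i hi => ?_, fun i j hj => ?_⟩
    · by_cases h : i = M
      · subst h; simpa using hw
      · rw [Function.update_of_ne h]; exact h1 i
    · by_cases h : i = M
      · subst h; simpa using hz (Or.inl hi)
      · rw [Function.update_of_ne h]; exact h2 i hi
    · by_cases h : i = M
      · subst h; simpa using hz (Or.inr hi)
      · rw [Function.update_of_ne h]; exact h3 i hi
    · have h : i ≠ M := by
        intro h; rw [h] at hi; simp only [hM] at hi; omega
      rw [Function.update_of_ne h]; exact h4 i (by omega)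
    · rw [hcongr i j (by omega)]
      by_cases h : j = M
      · subst h; simpa using ha i
      · have : (j : ℕ) ≠ m := fun h' => h (Fin.ext h')
        rw [Function.update_of_ne h]; exact h5 i j (by omega)
  by_cases hc : D.src M ≠ l ∨ m < q
  · refine ⟨0, zero_mem _, by simp, fun _ => rfl, fun i => ?_⟩
    rw [map_zero]
    refine (Finset.sum_eq_zero fun k _ => ?_).symm
    by_cases hne : D.c i M k = 0
    · simp [hne]
    have hk : φ k = 0 := by
      rcases hc with hc | hc
      · exact h2 k (by rwa [D.src_eq hne])
      · have := D.lt_right hne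
        rw [Fin.lt_def] at this
        exact h3 k (this.trans hc)
    simp [hk]
  · push Not at hc
    have hψ : (fun i => ∑ k, D.c i M k • φ k) ∈ D.partialHom (q + 1) d (D.tgt M) := by
      refine ⟨fun i => ?_, fun i hi => ?_, fun i hi => ?_, fun i hi => ?_, fun i j _ => ?_⟩
      · refine sum_mem fun k _ => ?_
        by_cases hne : D.c i M k = 0
        · simp [hne]
        · rw [← D.tgt_eq hne]
          exact Submodule.smul_mem _ _ (h1 k)
      · refine Finset.sum_eq_zero fun k _ => ?_
        by_cases hne : D.c i M k = 0
        · simp [hne]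
        · exact absurd (D.src_eq_tgt hne) hi
      · refine Finset.sum_eq_zero fun k _ => ?_
        by_cases hne : D.c i M k = 0
        · simp [hne]
        · have := D.lt_left hne
          rw [Fin.lt_def] at this
          rw [h3 k (by omega), smul_zero]
      · exact absurd i.2 (by omega)
      · simp only [map_sum, map_smul, Finset.smul_sum, smul_smul]
        have : ∀ k, D.c j M k • actL i (φ k) = ∑ k', (D.c j M k * D.c i k k') • φ k' := by
          intro k
          by_cases hne : D.c j M k = 0
          · simp [hne]
          · have := D.lt_right hne
            rw [Fin.lt_def] at this
            rw [h5 i k this, Finset.smul_sum]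
            simp only [smul_smul]
        simp only [this]
        rw [Finset.sum_comm]
        conv_rhs => rw [Finset.sum_comm]
        refine Finset.sum_congr rfl fun k' _ => ?_
        rw [← Finset.sum_smul, ← Finset.sum_smul, D.assoc]
    obtain ⟨w, hw, hws, hwa⟩ := D.exists_act_eq_of_mem_closure (H _ _ hψ) s
    exact ⟨w, hw, hws, fun h => absurd h (by push Not; exact hc), hwa⟩

/-- Restriction of a homomorphism to one basis element less. -/
theorem update_zero_mem_partialHom {q m : ℕ} {l : Λ} {φ : Fin d → FormalVertex K Λ d →₀ K}
    (hφ : φ ∈ D.partialHom q (m + 1) l) (hm : m < d) :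
    Function.update φ ⟨m, hm⟩ 0 ∈ D.partialHom q m l := by
  obtain ⟨h1, h2, h3, h4, h5⟩ := hφ
  refine ⟨fun i => ?_, fun i hi => ?_, fun i hi => ?_, fun i hi => ?_, fun i j hj => ?_⟩
  · by_cases h : i = ⟨m, hm⟩
    · subst h; simp
    · rw [Function.update_of_ne h]; exact h1 i
  · by_cases h : i = ⟨m, hm⟩
    · subst h; simp
    · rw [Function.update_of_ne h]; exact h2 i hi
  · by_cases h : i = ⟨m, hm⟩
    · subst h; simp
    · rw [Function.update_of_ne h]; exact h3 i hi
  · by_cases h : i = ⟨m, hm⟩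
    · subst h; simp
    · have : (i : ℕ) ≠ m := fun h' => h (Fin.ext h')
      rw [Function.update_of_ne h]; exact h4 i (by omega)
  · have h : j ≠ ⟨m, hm⟩ := by rintro rfl; simp at hj
    rw [Function.update_of_ne h, h5 i j (by omega)]
    refine Finset.sum_congr rfl fun k _ => ?_
    by_cases hk : k = ⟨m, hm⟩
    · have : D.c i j k = 0 := by
        by_contra hne
        have := D.lt_right hne
        rw [hk, Fin.lt_def] at this
        simp only at this
        omega
      simp [this]
    · rw [Function.update_of_ne hk]

/-- Every homomorphism is a sum of disjointly supported ones. The induction is downward on the number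
`q` of basis elements at which it vanishes, and upward on the number `m` of those at which it is
defined. -/
theorem mem_closure_splitHom (n : ℕ) : ∀ q m l, d ≤ q + n → m ≤ d → ∀ φ ∈ D.partialHom q m l,
    φ ∈ AddSubmonoid.closure (D.splitHom q m l) := by
  classical
  induction n with
  | zero =>
    intro q m l hq _ φ hφ
    have : φ = 0 := by
      ext1 i
      exact hφ.2.2.1 i (by omega)
    rw [this]
    exact zero_mem _
  | succ n ih =>
    intro q m l hq hm φ hφ
    have H : ∀ l, ∀ ψ ∈ D.partialHom (q + 1) d l,
        ψ ∈ AddSubmonoid.closure (D.splitHom (q + 1) d l) :=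
      fun l ψ hψ => ih (q + 1) d l (by omega) le_rfl ψ hψ
    induction m generalizing φ with
    | zero =>
      have : φ = 0 := by
        ext1 i
        exact hφ.2.2.2.1 i (by omega)
      rw [this]
      exact zero_mem _
    | succ m ihm =>
      -- each summand of the truncation extends by a sum of fresh vertices
      have hext : ∀ χ ∈ AddSubmonoid.closure (D.splitHom q m l),
          ∃ χ' ∈ AddSubmonoid.closure (D.splitHom q (m + 1) l),
            ∀ i : Fin d, (i : ℕ) ≠ m → χ' i = χ i := by
        intro χ hχ
        induction hχ using AddSubmonoid.closure_induction with
        | mem χ h =>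
          obtain ⟨w, hw, hmem⟩ := D.exists_update_mem_partialHom H hm h.1
            (Finset.univ.biUnion fun i => (χ i).support)
          have hdis : ∀ i, Disjoint w.support (χ i).support := fun i =>
            Finset.disjoint_of_subset_right
              (Finset.subset_biUnion_of_mem (fun i => (χ i).support) (Finset.mem_univ i)) hw
          refine ⟨_, AddSubmonoid.subset_closure ⟨hmem, fun i j hij => ?_⟩, fun i hi => ?_⟩
          · by_cases hi : i = ⟨m, hm⟩
            · have hj : j ≠ ⟨m, hm⟩ := fun hj => hij (hi.trans hj.symm)
              rw [Function.update_of_ne hj, hi, Function.update_self]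
              exact hdis j
            · rw [Function.update_of_ne hi]
              by_cases hj : j = ⟨m, hm⟩
              · rw [hj, Function.update_self]
                exact (hdis i).symm
              · rw [Function.update_of_ne hj]
                exact h.2 i j hij
          · rw [Function.update_of_ne (fun h => hi (by rw [h]))]
        | zero => exact ⟨0, zero_mem _, by simp⟩
        | add χ ψ _ _ h1 h2 =>
          obtain ⟨χ', h1, h1'⟩ := h1
          obtain ⟨ψ', h2, h2'⟩ := h2
          exact ⟨χ' + ψ', add_mem h1 h2, fun i hi => by simp [h1' i hi, h2' i hi]⟩
      obtain ⟨χ, hχ, heq⟩ := hext _ (ihm (by omega) _ (D.update_zero_mem_partialHom hφ hm))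
      -- the remainder is supported at one index
      have hrem : ∀ i : Fin d, (i : ℕ) ≠ m → (φ - χ) i = 0 := by
        intro i hi
        rw [Pi.sub_apply, heq i hi, Function.update_of_ne (fun h => hi (by rw [h])), sub_self]
      have hrem' : φ - χ ∈ D.splitHom q (m + 1) l := by
        refine ⟨sub_mem hφ (D.closure_splitHom_le _ _ _ hχ), fun i j hij => ?_⟩
        by_cases hi : (i : ℕ) = m
        · rw [hrem j fun hj => hij (Fin.ext (hi.trans hj.symm))]
          simp
        · rw [hrem i hi]
          simp
      rw [← sub_add_cancel φ χ]
      exact add_mem (AddSubmonoid.subset_closure hrem') hχ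

/-- A vertex that is annihilated by all `X_i`. -/
theorem exists_good_lab (l : Λ) : ∃ v, D.IsGood v ∧ v.lab = l ∧ ∀ i, act i v = 0 := by
  obtain ⟨v, h1, h2, -, h4⟩ := D.exists_good_vertex (q := 0) (l := l) (φ := 0)
    ⟨zero_mem _, by simp⟩ ∅
  exact ⟨v, h1, h2, h4⟩

/-- A homomorphism with prescribed source that does not vanish at `X_{i₀}`: start with the functional
dual to `X_{i₀}` on `X_0, …, X_{i₀}` and extend. -/
theorem exists_partialHom_ne_zero (i₀ : Fin d) (n : ℕ) (hn : (i₀ : ℕ) + 1 + n ≤ d) :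
    ∃ φ ∈ D.partialHom 0 (i₀ + 1 + n) (D.src i₀), φ i₀ ≠ 0 := by
  induction n with
  | zero =>
    obtain ⟨v, hg, hl, hv⟩ := D.exists_good_lab (D.tgt i₀)
    have h0 : ∀ i, i ≠ i₀ → (Pi.single i₀ (Finsupp.single v 1) :
        Fin d → FormalVertex K Λ d →₀ K) i = 0 := fun i hi => Pi.single_eq_of_ne hi _
    refine ⟨Pi.single i₀ (Finsupp.single v 1), ⟨fun i => ?_, fun i hi => ?_, fun i hi => ?_,
      fun i hi => ?_, fun i j hj => ?_⟩, by simp⟩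
    · by_cases h : i = i₀
      · subst h
        rw [Pi.single_eq_same]
        exact Finsupp.single_mem_supported K _ ⟨hg, hl⟩
      · rw [h0 i h]; exact zero_mem _
    · exact h0 i fun h => hi (by rw [h])
    · omega
    · refine h0 i fun h => ?_
      rw [h] at hi
      omega
    · have hl : actL i ((Pi.single i₀ (Finsupp.single v 1) :
          Fin d → FormalVertex K Λ d →₀ K) j) = 0 := by
        by_cases h : j = i₀
        · subst h; simp [hv]
        · rw [h0 j h, map_zero]
      rw [hl]
      refine (Finset.sum_eq_zero fun k _ => ?_).symm
      by_cases hne : D.c i j k = 0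
      · simp [hne]
      · have := D.lt_right hne
        rw [Fin.lt_def] at this
        rw [h0 k, smul_zero]
        rintro rfl
        omega
  | succ n ih =>
    obtain ⟨φ, hφ, hne⟩ := ih (by omega)
    obtain ⟨w, -, hw⟩ := D.exists_update_mem_partialHom
      (fun l ψ hψ => D.mem_closure_splitHom d _ d l (by omega) le_rfl ψ hψ)
      (by omega : (i₀ : ℕ) + 1 + n < d) hφ ∅
    refine ⟨_, hw, ?_⟩
    rw [Function.update_of_ne]
    · exact hne
    · intro h
      have := congrArg Fin.val h
      simp only at this
      omega

theorem exists_good_act_ne_zero (i₀ : Fin d) : ∃ v, D.IsGood v ∧ act i₀ v ≠ 0 := by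
  have hi := i₀.2
  obtain ⟨φ, hφ, hne⟩ := D.exists_partialHom_ne_zero i₀ (d - (i₀ + 1)) (by omega)
  rw [show (i₀ : ℕ) + 1 + (d - (i₀ + 1)) = d by omega] at hφ
  have hcl := D.mem_closure_splitHom d 0 d _ (by omega) le_rfl φ hφ
  by_contra hcon
  push Not at hcon
  refine hne ?_
  induction hcl using AddSubmonoid.closure_induction with
  | mem χ h =>
    obtain ⟨v, hg, -, -, hv⟩ := D.exists_good_vertex h ∅
    rw [← hv, hcon v hg]
  | zero => rfl
  | add χ ψ h1 h2 ih1 ih2 =>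
    by_cases hχ : χ i₀ = 0
    · by_cases hψ : ψ i₀ = 0
      · simp [hχ, hψ]
      · exact absurd (ih2 (D.closure_splitHom_le _ _ _ h2) hψ) hψ
    · exact absurd (ih1 (D.closure_splitHom_le _ _ _ h1) hχ) hχ

/-- A good vertex spans, together with its finitely many descendants, a submodule. -/
theorem exists_closed_finset {v : FormalVertex K Λ d} (hv : D.IsGood v) :
    ∃ s : Finset (FormalVertex K Λ d), v ∈ s ∧
      ∀ w ∈ s, D.IsGood w ∧ ∀ i, (act i w).support ⊆ s := by
  classical
  induction hv with
  | intro v good tgt src disj mul ih =>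
    choose! f hf using ih
    refine ⟨insert v (Finset.univ.biUnion fun i => (act i v).support.biUnion (f i)),
      Finset.mem_insert_self _ _, fun w hw => ?_⟩
    rcases Finset.mem_insert.1 hw with rfl | hw
    · refine ⟨⟨w, good, tgt, src, disj, mul⟩, fun i x hx => Finset.mem_insert_of_mem ?_⟩
      simp only [Finset.mem_biUnion]
      exact ⟨i, Finset.mem_univ i, x, hx, (hf i x hx).1⟩
    · simp only [Finset.mem_biUnion] at hw
      obtain ⟨i, -, x, hx, hw⟩ := hw
      obtain ⟨hg, hs⟩ := (hf i x hx).2 w hw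
      refine ⟨hg, fun j y hy => Finset.mem_insert_of_mem ?_⟩
      simp only [Finset.mem_biUnion]
      exact ⟨i, Finset.mem_univ i, x, hx, hs j hy⟩

/-- Labelled structure constants are represented by strictly upper triangular matrices such that at
each position at most one of them is nonzero. All basis elements act nontrivially, and all labels
occur. -/
theorem exists_monomial_representation [Finite Λ] :
    ∃ (n : ℕ) (lab : Fin n → Λ) (T : Fin d → Matrix (Fin n) (Fin n) K),
      (∀ l, ∃ r, lab r = l) ∧ (∀ i, ∃ r s, T i r s ≠ 0) ∧
      (∀ i r s, T i r s ≠ 0 → r < s ∧ lab r = D.tgt i ∧ lab s = D.src i) ∧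
      (∀ i j r s, T i r s ≠ 0 → T j r s ≠ 0 → i = j) ∧
      ∀ i j, T i * T j = ∑ k, D.c i j k • T k := by
  classical
  have := Fintype.ofFinite Λ
  choose v hv hv' using D.exists_good_act_ne_zero
  choose w hw hw' _ using D.exists_good_lab
  choose f hf hf' using fun i => D.exists_closed_finset (hv i)
  choose g hg hg' using fun l => D.exists_closed_finset (hw l)
  let s : Finset (FormalVertex K Λ d) := Finset.univ.biUnion f ∪ Finset.univ.biUnion g
  have hfs : ∀ i, f i ⊆ s := fun i => (Finset.subset_biUnion_of_mem f (Finset.mem_univ i)).trans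
    Finset.subset_union_left
  have hgs : ∀ l, g l ⊆ s := fun i => (Finset.subset_biUnion_of_mem g (Finset.mem_univ i)).trans
    Finset.subset_union_right
  have hs : ∀ x ∈ s, D.IsGood x ∧ ∀ i, (act i x).support ⊆ s := by
    intro x hx
    rcases Finset.mem_union.1 hx with hx | hx
    · obtain ⟨i, -, hx⟩ := Finset.mem_biUnion.1 hx
      exact ⟨(hf' i x hx).1, fun j => ((hf' i x hx).2 j).trans (hfs i)⟩
    · obtain ⟨i, -, hx⟩ := Finset.mem_biUnion.1 hx
      exact ⟨(hg' i x hx).1, fun j => ((hg' i x hx).2 j).trans (hgs i)⟩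
  obtain ⟨e, he⟩ := s.exists_equiv_fin_of_height FormalVertex.height
  refine ⟨s.card, fun r => (e r : FormalVertex K Λ d).lab, fun i => Matrix.of fun r q =>
    act i (e q : FormalVertex K Λ d) (e r), fun l => ?_, fun i => ?_, fun i r q h => ?_,
    fun i j r q hi hj => ?_, fun i j => ?_⟩
  · exact ⟨e.symm ⟨w l, hgs l (hg l)⟩, by simp [hw']⟩
  · have hvs : v i ∈ s := hfs i (hf i)
    obtain ⟨x, hx⟩ := Finsupp.support_nonempty_iff.2 (hv' i)
    refine ⟨e.symm ⟨x, (hs _ hvs).2 i hx⟩, e.symm ⟨v i, hvs⟩, ?_⟩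
    simpa using hx
  · have hmem : (e r : FormalVertex K Λ d) ∈ (act i (e q : FormalVertex K Λ d)).support :=
      Finsupp.mem_support_iff.2 h
    refine ⟨he _ _ (height_lt_of_mem_support hmem), ?_⟩
    obtain ⟨_, -, h1, h2, -, -⟩ := (hs _ (e q).2).1
    exact ⟨h1 i _ hmem, h2 i (Finsupp.support_nonempty_iff.1 ⟨_, hmem⟩)⟩
  · by_contra hij
    obtain ⟨_, -, -, -, h, -⟩ := (hs _ (e q).2).1
    exact Finset.disjoint_left.1 (h i j hij) (Finsupp.mem_support_iff.2 hi)
      (Finsupp.mem_support_iff.2 hj)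
  · ext r q
    obtain ⟨_, -, -, -, -, h⟩ := (hs _ (e q).2).1
    have h := DFunLike.congr_fun (h i j) (e r : FormalVertex K Λ d)
    simp only [Matrix.mul_apply, Matrix.of_apply, Matrix.sum_apply, Matrix.smul_apply,
      smul_eq_mul]
    simp only [Finsupp.coe_finsetSum, Finset.sum_apply, Finsupp.smul_apply, smul_eq_mul] at h
    rw [← h, actL, Finsupp.linearCombination_apply,
      Finsupp.sum_of_support_subset _ ((hs _ (e q).2).2 j) _ (by simp),
      Finsupp.coe_finsetSum, Finset.sum_apply,
      ← Finset.sum_coe_sort s, ← e.sum_comp]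
    exact Finset.sum_congr rfl fun p _ => by simp [mul_comm]

end LabelledConstants

/-! ### Block coordinates -/

/-- The size of the blocks with a given label. The label `none` stands for the zero diagonal blocks
of size one. -/
def blockSize {k : ℕ} (deg : Fin k → ℕ) : Option (Fin k) → ℕ
  | some u => deg u
  | none => 1

/-- Linear coordinates on an algebra `B`: the diagonal coordinates `y (some u) a b` describe the image
of an element in the simple factor `u` of `B` modulo its radical, and the coordinates `x i a b`
describe its radical part as a family of matrices indexed by labelled structure constants. Matrix
positions `a`, `b` are natural numbers, which avoids casts between blocks with equal labels; only the
coordinates with `a` and `b` in range are meaningful. -/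
structure BlockCoordinates (K B : Type*) [Field K] [NonUnitalRing B] [Module K B]
    [IsScalarTower K B B] [SMulCommClass K B B] where
  k : ℕ
  deg : Fin k → ℕ
  deg_pos : ∀ u, 0 < deg u
  d : ℕ
  D : LabelledConstants K (Option (Fin k)) d
  y : Option (Fin k) → ℕ → ℕ → B →ₗ[K] K
  x : Fin d → ℕ → ℕ → B →ₗ[K] K
  y_none : y none = 0
  y_mul : ∀ u a b, a < blockSize deg u → b < blockSize deg u → ∀ z z',
    y u a b (z * z') = ∑ e ∈ Finset.range (blockSize deg u), y u a e z * y u e b z'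
  x_mul : ∀ k a b, a < blockSize deg (D.tgt k) → b < blockSize deg (D.src k) → ∀ z z',
    x k a b (z * z') =
      ∑ e ∈ Finset.range (blockSize deg (D.tgt k)), y (D.tgt k) a e z * x k e b z' +
      ∑ e ∈ Finset.range (blockSize deg (D.src k)), x k a e z * y (D.src k) e b z' +
      ∑ i, ∑ j, D.c i j k *
        ∑ e ∈ Finset.range (blockSize deg (D.src i)), x i a e z * x j e b z'
  ext : ∀ z, (∀ u a b, a < deg u → b < deg u → y (some u) a b z = 0) →
    (∀ i a b, a < blockSize deg (D.tgt i) → b < blockSize deg (D.src i) → x i a b z = 0) → z = 0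
  exists_eq : ∀ (f : Fin k → ℕ → ℕ → K) (g : Fin d → ℕ → ℕ → K), ∃ z,
    (∀ u a b, a < deg u → b < deg u → y (some u) a b z = f u a b) ∧
    (∀ i a b, a < blockSize deg (D.tgt i) → b < blockSize deg (D.src i) → x i a b z = g i a b)
  mem_radical : ∀ z, z ∈ algebraRadical K B ↔
    ∀ u a b, a < deg u → b < deg u → y (some u) a b z = 0
  ne_none : (∃ e : B, ∀ x, e * x = x ∧ x * e = x) → ∀ i, D.tgt i ≠ none ∧ D.src i ≠ none

/-- If modulo the ideal `I` every variable is zero or a multiple of a variable from a set `R`, and the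
variables in `R` take arbitrary values on the set `W` on which `I` vanishes, then `I` contains all
polynomials that vanish on `W`. -/
theorem MvPolynomial.vanishingIdeal_le_of_representatives {K σ : Type*} [Field K]
    [Infinite K] (W : Set (σ → K)) (I : Ideal (MvPolynomial σ K))
    (hI : I ≤ MvPolynomial.vanishingIdeal K W) (R : Set σ)
    (hR : ∀ v, MvPolynomial.X v ∈ I ∨ ∃ w ∈ R, ∃ ν : K,
      MvPolynomial.X v - MvPolynomial.C ν * MvPolynomial.X w ∈ I)
    (hW : ∀ z : σ → K, ∃ w ∈ W, ∀ v ∈ R, w v = z v) :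
    MvPolynomial.vanishingIdeal K W ≤ I := by
  have ht : ∀ v, ∃ t : MvPolynomial σ K, MvPolynomial.X v - t ∈ I ∧
      ∀ z z' : σ → K, (∀ v ∈ R, z v = z' v) →
        MvPolynomial.aeval z t = MvPolynomial.aeval z' t := by
    intro v
    rcases hR v with h | ⟨w, hw, ν, h⟩
    · exact ⟨0, by simpa using h, by simp⟩
    · exact ⟨_, h, fun z z' hz => by simp [hz w hw]⟩
  choose t ht ht' using ht
  -- rewriting all variables in terms of the representatives does not change `p` modulo `I`
  have hsub : ∀ p, p - MvPolynomial.bind₁ t p ∈ I := by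
    intro p
    rw [← Ideal.Quotient.eq]
    have : (Ideal.Quotient.mkₐ K I) = (Ideal.Quotient.mkₐ K I).comp (MvPolynomial.bind₁ t) := by
      ext v
      simpa using (Ideal.Quotient.eq.2 (ht v))
    exact DFunLike.congr_fun this p
  intro p hp
  have h0 : MvPolynomial.bind₁ t p = 0 := by
    refine MvPolynomial.funext fun z => ?_
    obtain ⟨w, hw, hwz⟩ := hW z
    have h1 := MvPolynomial.mem_vanishingIdeal_iff.1 (hI (hsub p)) w hw
    have h2 := MvPolynomial.mem_vanishingIdeal_iff.1 hp w hw
    rw [map_sub, h2, zero_sub, neg_eq_zero, MvPolynomial.aeval_bind₁] at h1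
    have h3 : MvPolynomial.aeval z (MvPolynomial.bind₁ t p) = 0 := by
      rw [MvPolynomial.aeval_bind₁, ← h1]
      congr 2
      ext v
      exact ht' v _ _ fun v hv => (hwz v hv).symm
    simpa [MvPolynomial.coe_aeval_eq_eval] using h3
  have := hsub p
  rwa [h0, sub_zero] at this

namespace BlockCoordinates

variable {K B : Type*} [Field K] [NonUnitalRing B] [Module K B]
    [IsScalarTower K B B] [SMulCommClass K B B] (C : BlockCoordinates K B)

theorem eq_of_coordinates {z z' : B}
    (h : ∀ u a b, a < C.deg u → b < C.deg u → C.y (some u) a b z = C.y (some u) a b z')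
    (h' : ∀ i a b, a < blockSize C.deg (C.D.tgt i) → b < blockSize C.deg (C.D.src i) →
      C.x i a b z = C.x i a b z') : z = z' := by
  rw [← sub_eq_zero]
  refine C.ext _ (fun u a b ha hb => ?_) (fun i a b ha hb => ?_)
  · rw [map_sub, h u a b ha hb, sub_self]
  · rw [map_sub, h' i a b ha hb, sub_self]

/-- The elements whose radical coordinates vanish form a subalgebra isomorphic to the semisimple
quotient. -/
theorem exists_semisimplePart :
    ∃ σ : (∀ u, Matrix (Fin (C.deg u)) (Fin (C.deg u)) K) →ₙₐ[K] B,
      (∀ f u (a b : Fin (C.deg u)), C.y (some u) a b (σ f) = f u a b) ∧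
      (∀ f i a b, a < blockSize C.deg (C.D.tgt i) → b < blockSize C.deg (C.D.src i) →
        C.x i a b (σ f) = 0) := by
  classical
  have H : ∀ f : (∀ u, Matrix (Fin (C.deg u)) (Fin (C.deg u)) K), ∃ z : B,
      (∀ u (a b : Fin (C.deg u)), C.y (some u) a b z = f u a b) ∧
      (∀ i a b, a < blockSize C.deg (C.D.tgt i) → b < blockSize C.deg (C.D.src i) →
        C.x i a b z = 0) := by
    intro f
    obtain ⟨z, h1, h2⟩ := C.exists_eq
      (fun u a b => if h : a < C.deg u ∧ b < C.deg u then f u ⟨a, h.1⟩ ⟨b, h.2⟩ else 0) 0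
    exact ⟨z, fun u a b => by simp [h1 u a b a.2 b.2], fun i a b ha hb => by simp [h2 i a b ha hb]⟩
  choose s hs hs' using H
  have hs0 : ∀ f u a b (ha : a < C.deg u) (hb : b < C.deg u),
      C.y (some u) a b (s f) = f u ⟨a, ha⟩ ⟨b, hb⟩ := fun f u a b ha hb => hs f u ⟨a, ha⟩ ⟨b, hb⟩
  refine ⟨{ toFun := s, map_smul' := fun c f => ?_, map_zero' := ?_, map_add' := fun f g => ?_,
            map_mul' := fun f g => ?_ }, hs, hs'⟩
  · refine C.eq_of_coordinates (fun u a b ha hb => ?_) (fun i a b ha hb => ?_)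
    · simp [hs0 _ u a b ha hb]
    · simp [hs' _ i a b ha hb]
  · refine C.eq_of_coordinates (fun u a b ha hb => ?_) (fun i a b ha hb => ?_)
    · simp [hs0 _ u a b ha hb]
    · simp [hs' _ i a b ha hb]
  · refine C.eq_of_coordinates (fun u a b ha hb => ?_) (fun i a b ha hb => ?_)
    · simp [hs0 _ u a b ha hb]
    · simp [hs' _ i a b ha hb]
  · refine C.eq_of_coordinates (fun u a b ha hb => ?_) (fun i a b ha hb => ?_)
    · rw [C.y_mul (some u) a b ha hb, hs0 _ u a b ha hb, Pi.mul_apply, Matrix.mul_apply]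
      rw [show blockSize C.deg (some u) = C.deg u from rfl, Finset.sum_range]
      exact Finset.sum_congr rfl fun e _ => by rw [hs0 _ u a e ha e.2, hs0 _ u e b e.2 hb]
    · rw [hs' _ i a b ha hb, C.x_mul i a b ha hb]
      have h1 : ∑ e ∈ Finset.range (blockSize C.deg (C.D.tgt i)),
          C.y (C.D.tgt i) a e (s f) * C.x i e b (s g) = 0 :=
        Finset.sum_eq_zero fun e he => by
          rw [hs' g i e b (Finset.mem_range.1 he) hb, mul_zero]
      have h2 : ∑ e ∈ Finset.range (blockSize C.deg (C.D.src i)),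
          C.x i a e (s f) * C.y (C.D.src i) e b (s g) = 0 :=
        Finset.sum_eq_zero fun e he => by
          rw [hs' f i a e ha (Finset.mem_range.1 he), zero_mul]
      have h3 : ∑ i', ∑ j, C.D.c i' j i * ∑ e ∈ Finset.range (blockSize C.deg (C.D.src i')),
          C.x i' a e (s f) * C.x j e b (s g) = 0 := by
        refine Finset.sum_eq_zero fun i' _ => Finset.sum_eq_zero fun j _ => ?_
        by_cases hne : C.D.c i' j i = 0
        · rw [hne, zero_mul]
        · rw [Finset.sum_eq_zero, mul_zero]
          intro e he
          rw [hs' f i' a e (by rwa [← C.D.tgt_eq hne]) (Finset.mem_range.1 he), zero_mul]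
      rw [h1, h2, h3]
      simp

/-! ### The representation attached to block coordinates -/

section Representation

variable {n : ℕ} (lab : Fin n → Option (Fin C.k)) (T : Fin C.d → Matrix (Fin n) (Fin n) K)

/-- The entry at the position `(a, b)` of the block `(r, s)` of the representation. -/
def entry (r s : Fin n) (a b : ℕ) : B →ₗ[K] K :=
  (if r = s then C.y (lab r) a b else 0) + ∑ i, T i r s • C.x i a b

theorem entry_apply (r s : Fin n) (a b : ℕ) (z : B) : C.entry lab T r s a b z =
    (if r = s then C.y (lab r) a b z else 0) + ∑ i, T i r s * C.x i a b z := by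
  unfold entry
  split_ifs <;> simp

variable {lab T}

theorem entry_mul
    (hlab : ∀ i r s, T i r s ≠ 0 → r < s ∧ lab r = C.D.tgt i ∧ lab s = C.D.src i)
    (hmul : ∀ i j, T i * T j = ∑ k, C.D.c i j k • T k)
    (r s : Fin n) (a b : ℕ) (ha : a < blockSize C.deg (lab r)) (hb : b < blockSize C.deg (lab s))
    (z z' : B) : C.entry lab T r s a b (z * z') =
      ∑ q, ∑ e ∈ Finset.range (blockSize C.deg (lab q)),
        C.entry lab T r q a e z * C.entry lab T q s e b z' := by
  -- expand the right-hand side into four sums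
  have hR : ∑ q, ∑ e ∈ Finset.range (blockSize C.deg (lab q)),
        C.entry lab T r q a e z * C.entry lab T q s e b z' =
      (if r = s then ∑ e ∈ Finset.range (blockSize C.deg (lab r)),
        C.y (lab r) a e z * C.y (lab r) e b z' else 0) +
      (∑ k, T k r s * ∑ e ∈ Finset.range (blockSize C.deg (lab r)),
        C.y (lab r) a e z * C.x k e b z') +
      (∑ k, T k r s * ∑ e ∈ Finset.range (blockSize C.deg (lab s)),
        C.x k a e z * C.y (lab s) e b z') +
      ∑ q, ∑ i, ∑ j, (T i r q * T j q s) * ∑ e ∈ Finset.range (blockSize C.deg (lab q)),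
        C.x i a e z * C.x j e b z' := by
    have hexp : ∀ q e, C.entry lab T r q a e z * C.entry lab T q s e b z' =
        (if r = q then C.y (lab r) a e z else 0) * (if q = s then C.y (lab q) e b z' else 0) +
        (if r = q then C.y (lab r) a e z else 0) * ∑ i, T i q s * C.x i e b z' +
        (∑ i, T i r q * C.x i a e z) * (if q = s then C.y (lab q) e b z' else 0) +
        (∑ i, T i r q * C.x i a e z) * ∑ j, T j q s * C.x j e b z' := by
      intro q e
      rw [entry_apply, entry_apply]
      ring
    have e1 : ∀ q, (∑ e ∈ Finset.range (blockSize C.deg (lab q)),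
        (if r = q then C.y (lab r) a e z else 0) * (if q = s then C.y (lab q) e b z' else 0)) =
        if r = q then (if r = s then ∑ e ∈ Finset.range (blockSize C.deg (lab r)),
          C.y (lab r) a e z * C.y (lab r) e b z' else 0) else 0 := by
      intro q
      by_cases h : r = q
      · subst h
        by_cases h' : r = s <;> simp [h']
      · simp [h]
    have e2 : ∀ q, (∑ e ∈ Finset.range (blockSize C.deg (lab q)),
        (if r = q then C.y (lab r) a e z else 0) * ∑ i, T i q s * C.x i e b z') =
        if r = q then ∑ k, T k r s * ∑ e ∈ Finset.range (blockSize C.deg (lab r)),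
          C.y (lab r) a e z * C.x k e b z' else 0 := by
      intro q
      by_cases h : r = q
      · subst h
        simp only [if_true, Finset.mul_sum]
        rw [Finset.sum_comm]
        exact Finset.sum_congr rfl fun k _ => Finset.sum_congr rfl fun e _ => by ring
      · simp [h]
    have e3 : ∀ q, (∑ e ∈ Finset.range (blockSize C.deg (lab q)),
        (∑ i, T i r q * C.x i a e z) * (if q = s then C.y (lab q) e b z' else 0)) =
        if q = s then ∑ k, T k r s * ∑ e ∈ Finset.range (blockSize C.deg (lab s)),
          C.x k a e z * C.y (lab s) e b z' else 0 := by
      intro q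
      by_cases h : q = s
      · subst h
        simp only [if_true, Finset.mul_sum, Finset.sum_mul]
        rw [Finset.sum_comm]
        exact Finset.sum_congr rfl fun k _ => Finset.sum_congr rfl fun e _ => by ring
      · simp [h]
    have e4 : ∀ q, (∑ e ∈ Finset.range (blockSize C.deg (lab q)),
        (∑ i, T i r q * C.x i a e z) * ∑ j, T j q s * C.x j e b z') =
        ∑ i, ∑ j, (T i r q * T j q s) * ∑ e ∈ Finset.range (blockSize C.deg (lab q)),
          C.x i a e z * C.x j e b z' := by
      intro q
      simp_rw [Finset.sum_mul_sum]
      rw [Finset.sum_comm]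
      refine Finset.sum_congr rfl fun i _ => ?_
      rw [Finset.sum_comm]
      refine Finset.sum_congr rfl fun j _ => ?_
      rw [Finset.mul_sum]
      exact Finset.sum_congr rfl fun e _ => by ring
    simp_rw [hexp, Finset.sum_add_distrib, e1, e2, e3, e4]
    simp only [Finset.sum_ite_eq, Finset.sum_ite_eq', Finset.mem_univ, if_true]
  have h4 : ∑ q, ∑ i, ∑ j, (T i r q * T j q s) * ∑ e ∈ Finset.range (blockSize C.deg (lab q)),
        C.x i a e z * C.x j e b z' =
      ∑ k, T k r s * ∑ i, ∑ j, C.D.c i j k *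
        ∑ e ∈ Finset.range (blockSize C.deg (C.D.src i)), C.x i a e z * C.x j e b z' := by
    have s1 : ∀ q i j, (T i r q * T j q s) * ∑ e ∈ Finset.range (blockSize C.deg (lab q)),
        C.x i a e z * C.x j e b z' = (T i r q * T j q s) *
          ∑ e ∈ Finset.range (blockSize C.deg (C.D.src i)), C.x i a e z * C.x j e b z' := by
      intro q i j
      by_cases h : T i r q = 0
      · simp [h]
      · rw [(hlab i r q h).2.2]
    simp only [s1]
    rw [Finset.sum_comm]
    simp only [Finset.mul_sum (ι := Fin C.d)]
    rw [Finset.sum_comm (s := (Finset.univ : Finset (Fin C.d))) (t := Finset.univ)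
      (f := fun k i => ∑ j, T k r s * (C.D.c i j k *
        ∑ e ∈ Finset.range (blockSize C.deg (C.D.src i)), C.x i a e z * C.x j e b z'))]
    refine Finset.sum_congr rfl fun i _ => ?_
    rw [Finset.sum_comm]
    rw [Finset.sum_comm (s := (Finset.univ : Finset (Fin C.d))) (t := Finset.univ)
      (f := fun k j => T k r s * (C.D.c i j k *
        ∑ e ∈ Finset.range (blockSize C.deg (C.D.src i)), C.x i a e z * C.x j e b z'))]
    refine Finset.sum_congr rfl fun j _ => ?_
    have := congrFun (congrFun (hmul i j) r) s
    rw [Matrix.mul_apply, Matrix.sum_apply] at this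
    rw [← Finset.sum_mul, this, Finset.sum_mul]
    exact Finset.sum_congr rfl fun k _ => by rw [Matrix.smul_apply, smul_eq_mul]; ring
  rw [hR, h4, entry_apply]
  have hy : (if r = s then C.y (lab r) a b (z * z') else 0) =
      if r = s then ∑ e ∈ Finset.range (blockSize C.deg (lab r)),
        C.y (lab r) a e z * C.y (lab r) e b z' else 0 := by
    by_cases h : r = s
    · subst h
      simp only [if_true]
      exact C.y_mul _ a b ha hb z z'
    · simp [h]
  rw [hy, add_assoc, add_assoc, ← Finset.sum_add_distrib, ← Finset.sum_add_distrib]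
  congr 1
  refine Finset.sum_congr rfl fun k _ => ?_
  by_cases h : T k r s = 0
  · simp [h]
  · obtain ⟨-, h1, h2⟩ := hlab k r s h
    rw [C.x_mul k a b (by rwa [← h1]) (by rwa [← h2]), h1, h2]
    ring

end Representation

variable {n : ℕ} (lab : Fin n → Option (Fin C.k)) (hex : ∀ u, ∃ r, lab r = some u)

/-- The vertices of the quiver. A reducible definition, so that its projections unfold in types. -/
abbrev vertices : QuiverVertices where
  numComponents := C.k
  deg := C.deg
  deg_pos := C.deg_pos
  numVertices := n
  label := lab
  exists_label := hex

theorem vertices_size (o : Option (Fin C.k)) :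
    (C.vertices lab hex).size o = blockSize C.deg o := by
  cases o <;> rfl

variable {lab} {T : Fin C.d → Matrix (Fin n) (Fin n) K}
variable (hlab : ∀ i r s, T i r s ≠ 0 → r < s ∧ lab r = C.D.tgt i ∧ lab s = C.D.src i)
    (hmul : ∀ i j, T i * T j = ∑ k, C.D.c i j k • T k)

/-- The representation with the diagonal coordinates in the diagonal blocks and with
`∑ i, T i r s • x i` in the block `(r, s)`. -/
def representation :
    B →ₙₐ[K] Matrix (C.vertices lab hex).Idx (C.vertices lab hex).Idx K where
  toFun z := Matrix.of fun p q => C.entry lab T p.1 q.1 p.2 q.2 z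
  map_smul' c z := by ext; simp
  map_zero' := by ext; simp
  map_add' z z' := by ext; simp
  map_mul' z z' := by
    ext p q
    have ha : ∀ p : (C.vertices lab hex).Idx, (p.2 : ℕ) < blockSize C.deg (lab p.1) := fun p => by
      rw [← C.vertices_size lab hex]
      exact p.2.2
    rw [Matrix.mul_apply, Fintype.sum_sigma]
    simp only [Matrix.of_apply]
    rw [C.entry_mul hlab hmul p.1 q.1 p.2 q.2 (ha p) (ha q)]
    refine Finset.sum_congr rfl fun r _ => ?_
    rw [← C.vertices_size lab hex, Finset.sum_range]

theorem representation_apply (z : B) (p q : (C.vertices lab hex).Idx) :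
    C.representation hex hlab hmul z p q = C.entry lab T p.1 q.1 p.2 q.2 z := rfl

theorem entry_diag (r : Fin n) (a b : ℕ) (z : B)
    (hlab : ∀ i r s, T i r s ≠ 0 → r < s ∧ lab r = C.D.tgt i ∧ lab s = C.D.src i) :
    C.entry lab T r r a b z = C.y (lab r) a b z := by
  rw [entry_apply, if_pos rfl, Finset.sum_eq_zero, add_zero]
  intro i _
  by_cases h : T i r r = 0
  · rw [h, zero_mul]
  · exact absurd (hlab i r r h).1 (lt_irrefl r)

theorem entry_of_ne_zero (hone : ∀ i j r s, T i r s ≠ 0 → T j r s ≠ 0 → i = j)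
    (hlab : ∀ i r s, T i r s ≠ 0 → r < s ∧ lab r = C.D.tgt i ∧ lab s = C.D.src i)
    {i : Fin C.d} {r s : Fin n} (h : T i r s ≠ 0) (a b : ℕ) (z : B) :
    C.entry lab T r s a b z = T i r s * C.x i a b z := by
  rw [entry_apply, if_neg (hlab i r s h).1.ne, zero_add, Finset.sum_eq_single i]
  · intro j _ hj
    by_cases h' : T j r s = 0
    · rw [h', zero_mul]
    · exact absurd (hone j i r s h' h) hj
  · simp

theorem entry_eq_zero {r s : Fin n} (hrs : r ≠ s) (h : ∀ i, T i r s = 0) (a b : ℕ) (z : B) :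
    C.entry lab T r s a b z = 0 := by
  simp [entry_apply, hrs, h]

theorem block_representation_apply (z : B) (r s : Fin n) (i j) :
    (C.vertices lab hex).block (C.representation hex hlab hmul z) r s i j =
      C.entry lab T r s i j z := rfl

theorem blockSize_pos (o : Option (Fin C.k)) : 0 < blockSize C.deg o := by
  cases o
  · exact Nat.one_pos
  · exact C.deg_pos _

theorem exists_x_eq_one (i : Fin C.d) : ∃ z, C.x i 0 0 z = 1 := by
  obtain ⟨z, -, h⟩ := C.exists_eq 0 1
  exact ⟨z, by simpa using h i 0 0 (C.blockSize_pos _) (C.blockSize_pos _)⟩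

theorem fullQuiver_adj_of_ne_zero (hone : ∀ i j r s, T i r s ≠ 0 → T j r s ≠ 0 → i = j)
    {i : Fin C.d} {r s : Fin n} (h : T i r s ≠ 0) :
    (fullQuiver (C.vertices lab hex) (C.representation hex hlab hmul)).Adj r s := by
  obtain ⟨z, hz⟩ := C.exists_x_eq_one i
  refine ⟨(hlab i r s h).1.ne, z, fun h0 => h ?_⟩
  have := congrFun (congrFun h0 ⟨0, by
    rw [C.vertices_size]; exact C.blockSize_pos _⟩) ⟨0, by
    rw [C.vertices_size]; exact C.blockSize_pos _⟩
  rw [block_representation_apply, C.entry_of_ne_zero hone hlab h, hz, mul_one] at this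
  exact this

theorem exists_ne_zero_of_fullQuiver_adj {r s : Fin n}
    (h : (fullQuiver (C.vertices lab hex) (C.representation hex hlab hmul)).Adj r s) :
    ∃ i, T i r s ≠ 0 := by
  obtain ⟨hrs, z, hz⟩ := h
  by_contra hcon
  push Not at hcon
  refine hz ?_
  ext a b
  exact C.entry_eq_zero hrs hcon a b z

theorem representation_injective (hone : ∀ i j r s, T i r s ≠ 0 → T j r s ≠ 0 → i = j)
    (hocc : ∀ i, ∃ r s, T i r s ≠ 0) :
    Function.Injective (C.representation hex hlab hmul) := by
  intro z z' hz
  refine C.eq_of_coordinates (fun u a b ha hb => ?_) (fun i a b ha hb => ?_)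
  · obtain ⟨r, hr⟩ := hex u
    have hs : (C.vertices lab hex).size (lab r) = C.deg u := by rw [hr]; rfl
    have := congrFun (congrFun hz ⟨r, ⟨a, by rw [← hs] at ha; exact ha⟩⟩)
      ⟨r, ⟨b, by rw [← hs] at hb; exact hb⟩⟩
    simp only [representation_apply, C.entry_diag r _ _ _ hlab, hr] at this
    exact this
  · obtain ⟨r, s, hrs⟩ := hocc i
    obtain ⟨-, hr, hs⟩ := hlab i r s hrs
    rw [← hr, ← C.vertices_size lab hex] at ha
    rw [← hs, ← C.vertices_size lab hex] at hb
    have := congrFun (congrFun hz ⟨r, ⟨a, ha⟩⟩) ⟨s, ⟨b, hb⟩⟩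
    simp only [representation_apply, C.entry_of_ne_zero hone hlab hrs] at this
    exact mul_left_cancel₀ hrs this

theorem representation_isWedderburnBlockForm
    (hnone : (∃ e : B, ∀ x, e * x = x ∧ x * e = x) → ∀ r, lab r ≠ none) :
    IsWedderburnBlockForm (C.vertices lab hex) (C.representation hex hlab hmul) where
  semisimple_part := by
    obtain ⟨σ, hy, hx⟩ := C.exists_semisimplePart
    have hent : ∀ f r s a b, r ≠ s → a < blockSize C.deg (lab r) → b < blockSize C.deg (lab s) →
        C.entry lab T r s a b (σ f) = 0 := by
      intro f r s a b hrs ha hb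
      rw [entry_apply, if_neg hrs, zero_add]
      refine Finset.sum_eq_zero fun i _ => ?_
      by_cases h : T i r s = 0
      · rw [h, zero_mul]
      · obtain ⟨-, h1, h2⟩ := hlab i r s h
        rw [hx f i a b (by rwa [← h1]) (by rwa [← h2]), mul_zero]
    refine ⟨σ, fun f g hfg => ?_, ?_, fun f r s hrs => ?_, fun f r hr => ?_, fun f r u hr => ?_⟩
    · ext u a b
      rw [← hy f, ← hy g, hfg]
    · rw [isCompl_iff]
      constructor
      · rw [Submodule.disjoint_def]
        rintro z ⟨f, rfl⟩ hz
        rw [C.mem_radical] at hz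
        have : f = 0 := by
          ext u a b
          exact (hy f u a b).symm.trans (hz u a b a.2 b.2)
        subst this
        exact map_zero σ
      · rw [codisjoint_iff, Submodule.eq_top_iff']
        intro z
        let f : ∀ u, Matrix (Fin (C.deg u)) (Fin (C.deg u)) K :=
          fun u => Matrix.of fun a b => C.y (some u) a b z
        rw [← add_sub_cancel (σ f) z]
        refine Submodule.add_mem_sup ⟨f, rfl⟩ ((C.mem_radical _).2 fun u a b ha hb => ?_)
        have := hy f u ⟨a, ha⟩ ⟨b, hb⟩
        simp only at this
        rw [map_sub, this]
        simp [f]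
    · ext a b
      refine hent f r s a b hrs ?_ ?_
      · rw [← C.vertices_size lab hex]; exact a.2
      · rw [← C.vertices_size lab hex]; exact b.2
    · ext a b
      rw [block_representation_apply, C.entry_diag r _ _ _ hlab, show lab r = none from hr,
        C.y_none]
      rfl
    · have hr' : lab r = some u := hr
      have hs : (C.vertices lab hex).size ((C.vertices lab hex).label r) = C.deg u := by
        rw [hr]; rfl
      constructor
      · intro h
        ext a b
        have := congrFun (congrFun h (Fin.cast hs.symm a)) (Fin.cast hs.symm b)
        rw [block_representation_apply, C.entry_diag r _ _ _ hlab, hr'] at this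
        exact (hy f u a b).symm.trans this
      · intro h
        ext a b
        rw [block_representation_apply, C.entry_diag r _ _ _ hlab, hr']
        have := hy f u (Fin.cast hs a) (Fin.cast hs b)
        rw [h] at this
        exact this
  radical_part := by
    intro z hz r s hrs
    rw [C.mem_radical] at hz
    ext a b
    rw [block_representation_apply, Matrix.zero_apply]
    rcases hrs.lt_or_eq with h | h
    · refine C.entry_eq_zero h.ne' (fun i => ?_) _ _ _
      by_contra hne
      exact absurd (hlab i r s hne).1 h.asymm
    · subst h
      rw [C.entry_diag s _ _ _ hlab]
      have ha := a.2.trans_eq (C.vertices_size lab hex (lab s))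
      have hb := b.2.trans_eq (C.vertices_size lab hex (lab s))
      cases hs : lab s with
      | none => simp [C.y_none]
      | some u =>
        rw [hs] at ha hb
        exact hz u a b ha hb
  zero_block := hnone

theorem polynomialRelations_representation [Infinite K]
    (hone : ∀ i j r s, T i r s ≠ 0 → T j r s ≠ 0 → i = j) (hocc : ∀ i, ∃ r s, T i r s ≠ 0) :
    polynomialRelations (Set.range (C.representation hex hlab hmul)) =
      Ideal.span {f | IsGluingRelation (C.vertices lab hex) (C.representation hex hlab hmul) f} := by
  let P := C.vertices lab hex
  let ρ := C.representation hex hlab hmul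
  have hle : Ideal.span {f | IsGluingRelation P ρ f} ≤ polynomialRelations (Set.range ρ) := by
    rw [Ideal.span_le]
    intro f hf
    rw [polynomialRelations, SetLike.mem_coe, MvPolynomial.mem_vanishingIdeal_iff]
    rintro _ ⟨_, ⟨z, rfl⟩, rfl⟩
    cases hf with
    | below_diagonal r s h i j =>
      rw [MvPolynomial.aeval_X]
      refine C.entry_eq_zero h.ne' (fun i => ?_) _ _ _
      by_contra hne
      exact absurd (hlab i r s hne).1 h.asymm
    | zero_block r h i j =>
      rw [MvPolynomial.aeval_X]
      change C.entry lab T r r i j z = 0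
      rw [C.entry_diag r _ _ _ hlab, show lab r = none from h, C.y_none]
      rfl
    | diagonal r r' h i j =>
      rw [map_sub, MvPolynomial.aeval_X, MvPolynomial.aeval_X, sub_eq_zero]
      change C.entry lab T r' r' i j z = C.entry lab T r r i j z
      rw [C.entry_diag r _ _ _ hlab, C.entry_diag r' _ _ _ hlab, show lab r = lab r' from h]
    | no_arrow r s hrs h i j =>
      rw [MvPolynomial.aeval_X]
      by_contra hne
      refine h ⟨hrs.ne, z, fun h0 => hne ?_⟩
      exact congrFun (congrFun h0 i) j
    | proportional hr hs ν h i j =>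
      rw [map_sub, map_mul, MvPolynomial.aeval_X, MvPolynomial.aeval_X, MvPolynomial.aeval_C,
        sub_eq_zero]
      exact h.2.2 z i j
  refine le_antisymm ?_ hle
  have hex' := hex
  choose ru hru using hex'
  choose ri si hrs using hocc
  refine MvPolynomial.vanishingIdeal_le_of_representatives _ _ hle
    ({v | ∃ u, v.1.1 = ru u ∧ v.2.1 = ru u} ∪ {v | ∃ i, v.1.1 = ri i ∧ v.2.1 = si i}) ?_ ?_
  · rintro ⟨⟨r, a⟩, ⟨s, b⟩⟩
    rcases lt_trichotomy r s with h | h | h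
    · by_cases hadj : (fullQuiver P ρ).Adj r s
      · right
        obtain ⟨i, hi⟩ := C.exists_ne_zero_of_fullQuiver_adj _ hlab hmul hadj
        have h1 : P.label (ri i) = P.label r :=
          (hlab i _ _ (hrs i)).2.1.trans (hlab i _ _ hi).2.1.symm
        have h2 : P.label (si i) = P.label s :=
          (hlab i _ _ (hrs i)).2.2.trans (hlab i _ _ hi).2.2.symm
        refine ⟨(⟨ri i, P.samePos h1.symm a⟩, ⟨si i, P.samePos h2.symm b⟩),
          Or.inr ⟨i, rfl, rfl⟩, T i r s / T i (ri i) (si i), Ideal.subset_span ?_⟩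
        refine IsGluingRelation.proportional h1 h2 _
          ⟨C.fullQuiver_adj_of_ne_zero _ hlab hmul hone (hrs i), hadj, fun z a b => ?_⟩
          (P.samePos h1.symm a) (P.samePos h2.symm b)
        rw [block_representation_apply, block_representation_apply,
          C.entry_of_ne_zero hone hlab hi, C.entry_of_ne_zero hone hlab (hrs i), ← mul_assoc,
          div_mul_cancel₀ _ (hrs i)]
        rfl
      · exact Or.inl (Ideal.subset_span (.no_arrow r s h hadj a b))
    · subst h
      cases hl : lab r with
      | none => exact Or.inl (Ideal.subset_span (.zero_block r hl a b))
      | some u =>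
        right
        have h1 : P.label (ru u) = P.label r := (hru u).trans hl.symm
        refine ⟨(⟨ru u, P.samePos h1.symm a⟩, ⟨ru u, P.samePos h1.symm b⟩),
          Or.inl ⟨u, rfl, rfl⟩, 1, Ideal.subset_span ?_⟩
        rw [map_one, one_mul]
        exact IsGluingRelation.diagonal _ _ h1 (P.samePos h1.symm a) (P.samePos h1.symm b)
    · exact Or.inl (Ideal.subset_span (.below_diagonal r s h a b))
  · -- prescribe the coordinates of an element by the values at the representatives
    intro w
    let val : Fin n → Fin n → ℕ → ℕ → K := fun r s a b =>
      if h : a < P.size (lab r) ∧ b < P.size (lab s) then w (⟨r, ⟨a, h.1⟩⟩, ⟨s, ⟨b, h.2⟩⟩) else 0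
    have hval : ∀ r s (a : Fin (P.size (lab r))) (b : Fin (P.size (lab s))),
        val r s a b = w (⟨r, a⟩, ⟨s, b⟩) := fun r s a b => dif_pos ⟨a.2, b.2⟩
    obtain ⟨z, hzy, hzx⟩ := C.exists_eq (fun u a b => val (ru u) (ru u) a b)
      (fun i a b => (T i (ri i) (si i))⁻¹ * val (ri i) (si i) a b)
    refine ⟨_, ⟨_, ⟨z, rfl⟩, rfl⟩, ?_⟩
    rintro ⟨⟨r, a⟩, ⟨s, b⟩⟩ (⟨u, h1, h2⟩ | ⟨i, h1, h2⟩)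
    · simp only at h1 h2
      subst h1
      subst h2
      have ha := a.2.trans_eq (C.vertices_size lab hex (lab (ru u)))
      have hb := b.2.trans_eq (C.vertices_size lab hex (lab (ru u)))
      rw [hru u] at ha hb
      change C.entry lab T _ _ a b z = _
      rw [C.entry_diag _ _ _ _ hlab, hru u, hzy u a b ha hb]
      exact hval _ _ a b
    · simp only at h1 h2
      subst h1
      subst h2
      have ha := a.2.trans_eq (C.vertices_size lab hex (lab (ri i)))
      have hb := b.2.trans_eq (C.vertices_size lab hex (lab (si i)))
      rw [(hlab i _ _ (hrs i)).2.1] at ha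
      rw [(hlab i _ _ (hrs i)).2.2] at hb
      change C.entry lab T _ _ a b z = _
      rw [C.entry_of_ne_zero hone hlab (hrs i), hzx i a b ha hb, ← mul_assoc,
        mul_inv_cancel₀ (hrs i), one_mul]
      exact hval _ _ a b

end BlockCoordinates

/-- The labels of the vertices are restricted to those that are different from `none` if `B` has a
`1`, which is possible as all arrows avoid `none` in this case. -/
theorem BlockCoordinates.exists_representation {K B : Type*} [Field K] [Infinite K]
    [NonUnitalRing B] [Module K B] [IsScalarTower K B B] [SMulCommClass K B B]
    (C : BlockCoordinates K B) :
    ∃ (P : QuiverVertices) (ρ : B →ₙₐ[K] Matrix P.Idx P.Idx K),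
      Function.Injective ρ ∧ IsWedderburnBlockForm P ρ ∧
        polynomialRelations (Set.range ρ) = Ideal.span {f | IsGluingRelation P ρ f} := by
  let Λ := {o : Option (Fin C.k) // (∃ e : B, ∀ x, e * x = x ∧ x * e = x) → o ≠ none}
  let D' : LabelledConstants K Λ C.d :=
    { tgt := fun i => ⟨C.D.tgt i, fun h => (C.ne_none h i).1⟩
      src := fun i => ⟨C.D.src i, fun h => (C.ne_none h i).2⟩
      c := C.D.c
      lt_left := C.D.lt_left
      lt_right := C.D.lt_right
      src_eq_tgt := fun h => Subtype.ext (C.D.src_eq_tgt h)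
      tgt_eq := fun h => Subtype.ext (C.D.tgt_eq h)
      src_eq := fun h => Subtype.ext (C.D.src_eq h)
      assoc := C.D.assoc }
  obtain ⟨n, lab, T, hall, hocc, hlab, hone, hmul⟩ := D'.exists_monomial_representation
  have hex : ∀ u, ∃ r, (lab r : Option (Fin C.k)) = some u := by
    intro u
    obtain ⟨r, hr⟩ := hall ⟨some u, fun _ => Option.some_ne_none u⟩
    exact ⟨r, by rw [hr]⟩
  have hlab' : ∀ i r s, T i r s ≠ 0 →
      r < s ∧ (lab r : Option (Fin C.k)) = C.D.tgt i ∧ (lab s : Option (Fin C.k)) = C.D.src i :=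
    fun i r s h => ⟨(hlab i r s h).1, congrArg Subtype.val (hlab i r s h).2.1,
      congrArg Subtype.val (hlab i r s h).2.2⟩
  exact ⟨C.vertices (fun r => lab r) hex, C.representation hex hlab' hmul,
    C.representation_injective hex hlab' hmul hone hocc,
    C.representation_isWedderburnBlockForm hex hlab' hmul fun h r => (lab r).2 h,
    C.polynomialRelations_representation hex hlab' hmul hone hocc⟩

/-! ### Lifting matrix units -/

section Lifting

variable {R S : Type*} [Ring R] [Ring S]

/-- Idempotents that become isomorphic modulo a nil ideal are isomorphic. -/
theorem exists_lift_of_isNilpotent_ker (f : R →+* S) (hf : Function.Surjective f)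
    (hker : ∀ x ∈ RingHom.ker f, IsNilpotent x) {e e' : R} (he : IsIdempotentElem e)
    (he' : IsIdempotentElem e') {x y : S} (hx : f e * x = x) (hx' : x * f e' = x)
    (hy : f e' * y = y) (hy' : y * f e = y) (hxy : x * y = f e) (hyx : y * x = f e') :
    ∃ p q : R, f p = x ∧ f q = y ∧ e * p = p ∧ p * e' = p ∧ e' * q = q ∧ q * e = q ∧
      p * q = e ∧ q * p = e' := by
  obtain ⟨p₁, rfl⟩ := hf x
  obtain ⟨q₁, rfl⟩ := hf y
  have he2 : e * e = e := he
  have he2' : e' * e' = e' := he'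
  set p := e * p₁ * e' with hp
  set q₀ := e' * q₁ * e with hq₀
  have fp : f p = f p₁ := by rw [hp, map_mul, map_mul, hx, hx']
  have fq₀ : f q₀ = f q₁ := by rw [hq₀, map_mul, map_mul, hy, hy']
  have ep : e * p = p := by rw [hp, ← mul_assoc, ← mul_assoc, he2]
  have pe : p * e' = p := by rw [hp, mul_assoc, he2']
  have eq₀ : e' * q₀ = q₀ := by rw [hq₀, ← mul_assoc, ← mul_assoc, he2']
  have q₀e : q₀ * e = q₀ := by rw [hq₀, mul_assoc, he2]
  -- `p * q₀` agrees with `e` up to the nilpotent element `e - p * q₀` of the corner of `e`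
  obtain ⟨g, hg⟩ := (hker (e - p * q₀) (by
    rw [RingHom.mem_ker, map_sub, map_mul, fp, fq₀, hxy, sub_self])).isUnit_one_sub
  have h1 : e * (g : R) = p * q₀ := by
    rw [hg, mul_sub, mul_one, mul_sub, he2, ← mul_assoc, ep]
    abel
  have h2 : (g : R) * e = p * q₀ := by
    rw [hg, sub_mul, one_mul, sub_mul, he2, mul_assoc p, q₀e]
    abel
  have fg : f (g : R) = 1 := by
    rw [hg, map_sub, map_one, map_sub, map_mul, fp, fq₀, hxy, sub_self, sub_zero]
  have fg' : f ((g⁻¹ : Rˣ) : R) = 1 := by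
    have : f ((g⁻¹ : Rˣ) : R) * f (g : R) = 1 := by rw [← map_mul, Units.inv_mul, map_one]
    rwa [fg, mul_one] at this
  have hge : ((g⁻¹ : Rˣ) : R) * e = e * ((g⁻¹ : Rˣ) : R) := by
    rw [Units.inv_mul_eq_iff_eq_mul, ← mul_assoc, h2, ← h1, mul_assoc, Units.mul_inv, mul_one]
  set q := q₀ * ((g⁻¹ : Rˣ) : R) with hq
  have pq : p * q = e := by
    rw [hq, ← mul_assoc, ← h1, mul_assoc, Units.mul_inv, mul_one]
  have e'q : e' * q = q := by rw [hq, ← mul_assoc, eq₀]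
  have qe : q * e = q := by rw [hq, mul_assoc, hge, ← mul_assoc, q₀e]
  have fq : f q = f q₁ := by rw [hq, map_mul, fg', mul_one, fq₀]
  refine ⟨p, q, fp, fq, ep, pe, e'q, qe, pq, ?_⟩
  have hqp : q * p * (q * p) = q * p := by
    rw [mul_assoc, ← mul_assoc p, pq, ep]
  have : e' - q * p = 0 := by
    refine IsIdempotentElem.eq_zero_of_isNilpotent ?_ (hker _ ?_)
    · have h1 : e' * (q * p) = q * p := by rw [← mul_assoc, e'q]
      have h2 : q * p * e' = q * p := by rw [mul_assoc, pe]
      rw [IsIdempotentElem, sub_mul, mul_sub, mul_sub, he2', hqp, h1, h2]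
      abel
    · rw [RingHom.mem_ker, map_sub, map_mul, fp, fq, hyx, sub_self]
  exact (sub_eq_zero.1 this).symm

end Lifting

/-- A full set of matrix units of an algebra `R` modulo an ideal `J` (in applications, the radical),
lifted to `R`. The label `u` has an idempotent `e u`, the elements `p u a` and `q u a` for `a < n u`
represent the matrix units in the first row and the first column, and `φ u` is the first diagonal
matrix entry of the image in the factor `u` of `R / J`. -/
structure PeirceDecomposition (K : Type*) {R : Type*} [Field K] [Ring R] [Algebra K R]
    (J : Ideal R) {Λ : Type*} [Fintype Λ] [DecidableEq Λ] (n : Λ → ℕ) where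
  e : Λ → R
  p : Λ → ℕ → R
  q : Λ → ℕ → R
  φ : Λ → R →ₗ[K] K
  e_mul_e : ∀ u v, e u * e v = if u = v then e u else 0
  p_mul_q : ∀ u v a b, a < n u → b < n v → p u a * q v b = if u = v ∧ a = b then e u else 0
  sum_q_mul_p : ∑ u, ∑ a ∈ Finset.range (n u), q u a * p u a = 1
  e_mul_p : ∀ u a, a < n u → e u * p u a = p u a
  q_mul_e : ∀ u a, a < n u → q u a * e u = q u a
  φ_mem : ∀ u, ∀ z ∈ J, φ u z = 0
  φ_e : ∀ u, φ u (e u) = 1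
  sub_mem : ∀ u z, e u * z * e u - φ u z • e u ∈ J
  mem_of_ne : ∀ u v z, u ≠ v → e u * z * e v ∈ J

/-- Change of the index type of the simple factors. -/
def PeirceDecomposition.reindex {K R : Type*} [Field K] [Ring R] [Algebra K R] {J : Ideal R}
    {Λ Λ' : Type*} [Fintype Λ] [DecidableEq Λ] [Fintype Λ'] [DecidableEq Λ'] {n : Λ → ℕ}
    (P : PeirceDecomposition K J n) (θ : Λ' ≃ Λ) : PeirceDecomposition K J (n ∘ θ) where
  e := P.e ∘ θ
  p := P.p ∘ θ
  q := P.q ∘ θ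
  φ := P.φ ∘ θ
  e_mul_e u v := by simp [P.e_mul_e]
  p_mul_q u v a b ha hb := by
    simp only [Function.comp_apply, P.p_mul_q _ _ a b ha hb, θ.injective.eq_iff]
  sum_q_mul_p := by
    rw [← P.sum_q_mul_p, ← θ.sum_comp]
    rfl
  e_mul_p u a ha := P.e_mul_p _ a ha
  q_mul_e u a ha := P.q_mul_e _ a ha
  φ_mem u := P.φ_mem _
  φ_e u := P.φ_e _
  sub_mem u := P.sub_mem _
  mem_of_ne u v z h := P.mem_of_ne _ _ z (θ.injective.ne h)

theorem exists_peirceDecomposition_of_surjective {K R Λ : Type*} [Field K] [Ring R] [Algebra K R]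
    [Fintype Λ] [DecidableEq Λ] (n : Λ → ℕ) (hn : ∀ u, 0 < n u)
    (Φ : R →ₐ[K] ∀ u, Matrix (Fin (n u)) (Fin (n u)) K) (hΦ : Function.Surjective Φ)
    (J : Ideal R) (hJ : ∀ z, z ∈ J ↔ Φ z = 0) (hnil : ∀ z ∈ J, IsNilpotent z) :
    Nonempty (PeirceDecomposition K J n) := by
  classical
  have : ∀ u, NeZero (n u) := fun u => ⟨(hn u).ne'⟩
  let E : ∀ u, Fin (n u) → Fin (n u) → (∀ u, Matrix (Fin (n u)) (Fin (n u)) K) :=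
    fun u a b => Pi.single u (Matrix.single a b 1)
  have hE : ∀ u a b c, E u a b * E u b c = E u a c := by
    intro u a b c
    simp [E, ← Pi.single_mul]
  have hE0 : ∀ u a b b' c, b ≠ b' → E u a b * E u b' c = 0 := by
    intro u a b b' c h
    simp [E, ← Pi.single_mul, Matrix.single_mul_single_of_ne _ _ _ _ h]
  have hE1 : ∀ u v a b c d, u ≠ v → E u a b * E v c d = 0 := by
    intro u v a b c d h
    ext w : 1
    by_cases hw : w = u
    · subst hw
      simp [E, Pi.single_eq_of_ne h]
    · simp [E, Pi.single_eq_of_ne hw]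
  let E' : (Σ u, Fin (n u)) → (∀ u, Matrix (Fin (n u)) (Fin (n u)) K) := fun x => E x.1 x.2 x.2
  have hE' : CompleteOrthogonalIdempotents E' := by
    refine ⟨⟨fun x => hE _ _ _ _, ?_⟩, ?_⟩
    · rintro ⟨u, a⟩ ⟨v, b⟩ h
      by_cases huv : u = v
      · subst huv
        exact hE0 u a a b b fun hab => h (by rw [hab])
      · exact hE1 u v a a b b huv
    · rw [Fintype.sum_sigma]
      ext u : 1
      rw [Finset.sum_apply, Finset.sum_eq_single u]
      · rw [Finset.sum_apply]
        simpa [E', E] using Matrix.sum_single_one (m := Fin (n u)) (α := K)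
      · intro v _ hv
        simp [E', E, Pi.single_eq_of_ne hv.symm]
      · simp
  let Φr : R →+* ∀ u, Matrix (Fin (n u)) (Fin (n u)) K := Φ.toRingHom
  have hker : ∀ x ∈ RingHom.ker Φr, IsNilpotent x := fun x hx => hnil x ((hJ x).2 hx)
  obtain ⟨ε, hε, hεE⟩ := CompleteOrthogonalIdempotents.lift_of_isNilpotent_ker
    Φr hker hE' fun x => hΦ _
  have hεE' : ∀ u a, Φr (ε ⟨u, a⟩) = E u a a := fun u a => congrFun hεE ⟨u, a⟩
  have hεE : ∀ u a, Φ (ε ⟨u, a⟩) = E u a a := hεE'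
  have hpq := fun u (a : Fin (n u)) => exists_lift_of_isNilpotent_ker Φr hΦ hker
    (hε.idem ⟨u, 0⟩) (hε.idem ⟨u, a⟩) (x := E u 0 a) (y := E u a 0)
    (by rw [hεE', hE]) (by rw [hεE', hE])
    (by rw [hεE', hE]) (by rw [hεE', hE])
    (by rw [hεE', hE]) (by rw [hεE', hE])
  choose p q hp hq h1 h2 h3 h4 h5 h6 using hpq
  let φ : Λ → R →ₗ[K] K := fun u =>
    { toFun := fun z => Φ z u 0 0
      map_add' := by simp
      map_smul' := by simp }
  have hcorner : ∀ u (M : ∀ u, Matrix (Fin (n u)) (Fin (n u)) K),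
      E u 0 0 * M * E u 0 0 = M u 0 0 • E u 0 0 := by
    intro u M
    ext w : 1
    by_cases hw : w = u
    · subst hw
      simp [E]
    · simp [E, Pi.single_eq_of_ne hw]
  have hcorner' : ∀ u v (M : ∀ u, Matrix (Fin (n u)) (Fin (n u)) K), u ≠ v →
      E u 0 0 * M * E v 0 0 = 0 := by
    intro u v M huv
    ext w : 1
    by_cases hw : w = u
    · subst hw
      simp [E, Pi.single_eq_of_ne huv]
    · simp [E, Pi.single_eq_of_ne hw]
  refine ⟨{
    e := fun u => ε ⟨u, 0⟩
    p := fun u a => if h : a < n u then p u ⟨a, h⟩ else 0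
    q := fun u a => if h : a < n u then q u ⟨a, h⟩ else 0
    φ := φ
    e_mul_e := fun u v => ?_
    p_mul_q := fun u v a b ha hb => ?_
    sum_q_mul_p := ?_
    e_mul_p := fun u a ha => ?_
    q_mul_e := fun u a ha => ?_
    φ_mem := fun u z hz => ?_
    φ_e := fun u => ?_
    sub_mem := fun u z => ?_
    mem_of_ne := fun u v z huv => ?_ }⟩
  · rw [hε.mul_eq]
    by_cases h : u = v
    · subst h; simp
    · rw [if_neg h, if_neg fun h' => h (congrArg Sigma.fst h')]
  · simp only [dif_pos ha, dif_pos hb]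
    rw [← h2 u ⟨a, ha⟩, ← h3 v ⟨b, hb⟩, mul_assoc, ← mul_assoc (ε _), hε.mul_eq]
    by_cases h : u = v ∧ a = b
    · obtain ⟨rfl, rfl⟩ := h
      rw [if_pos rfl, if_pos ⟨rfl, rfl⟩, h3, h5]
    · rw [if_neg h, if_neg, zero_mul, mul_zero]
      intro h'
      apply h
      have := Sigma.mk.inj_iff.1 h'
      obtain ⟨rfl, h''⟩ := this
      exact ⟨rfl, congrArg Fin.val (eq_of_heq h'')⟩
  · rw [← hε.complete, Fintype.sum_sigma]
    refine Finset.sum_congr rfl fun u _ => ?_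
    rw [Finset.sum_range]
    exact Finset.sum_congr rfl fun a _ => by simp [h6]
  · simp [ha, h1]
  · simp [ha, h4]
  · simp [φ, (hJ z).1 hz]
  · simp [φ, hεE, E]
  · rw [hJ, map_sub, map_mul, map_mul, map_smul, hεE]
    rw [hcorner]
    exact sub_self _
  · rw [hJ, map_mul, map_mul, hεE, hεE]
    exact hcorner' u v _ huv

theorem exists_peirceDecomposition (K R : Type*) [Field K] [IsAlgClosed K] [Ring R] [Algebra K R]
    [FiniteDimensional K R] : ∃ (m : ℕ) (n : Fin m → ℕ), (∀ u, 0 < n u) ∧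
      Nonempty (PeirceDecomposition K (Ring.jacobson R) n) := by
  have := IsArtinianRing.of_finite K R
  obtain ⟨m, n, hn, ⟨Ψ⟩⟩ :=
    IsSemisimpleRing.exists_algEquiv_pi_matrix_of_isAlgClosed K (R ⧸ Ring.jacobson R)
  refine ⟨m, n, fun u => Nat.pos_of_ne_zero (hn u).out,
    exists_peirceDecomposition_of_surjective n (fun u => Nat.pos_of_ne_zero (hn u).out)
      (Ψ.toAlgHom.comp (Ideal.Quotient.mkₐ K (Ring.jacobson R)))
      (Ψ.surjective.comp Ideal.Quotient.mk_surjective) _ (fun z => ?_) (fun z hz => ?_)⟩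
  · simp [Ideal.Quotient.eq_zero_iff_mem]
  · obtain ⟨N, hN⟩ := IsSemiprimaryRing.isNilpotent (R := R)
    exact ⟨N, by simpa [hN] using Ideal.pow_mem_pow hz N⟩

/-! ### Adapted bases of the radical -/

/-- A linearly independent family of elements of an ideal `J`, homogeneous with respect to the
idempotents `e`, such that products of `X k` with elements of `J` lie in the span of the earlier
members. The deepest elements come first. -/
structure AdaptedFamily (K : Type*) {R : Type*} [Field K] [Ring R] [Algebra K R]
    (J : Ideal R) {Λ : Type*} (e : Λ → R) (d : ℕ) where
  X : Fin d → R
  tgt : Fin d → Λ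
  src : Fin d → Λ
  mem : ∀ k, X k ∈ J
  e_mul_X : ∀ k, e (tgt k) * X k = X k
  X_mul_e : ∀ k, X k * e (src k) = X k
  linearIndependent : LinearIndependent K X
  mul_X_mem : ∀ k u, ∀ z ∈ J, e u * z * X k ∈ Submodule.span K (X '' Set.Iio k)
  X_mul_mem : ∀ k u, ∀ z ∈ J, X k * z * e u ∈ Submodule.span K (X '' Set.Iio k)

namespace AdaptedFamily

variable {K R Λ : Type*} [Field K] [Ring R] [Algebra K R] {J : Ideal R}

/-- An adapted family that does not yet span the Peirce components of `J` can be enlarged, by an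
element from the deepest power of `J` that is not contained in the span. -/
theorem exists_succ [J.IsTwoSided] (hJ : IsNilpotent J) {e : Λ → R} (he : ∀ u, e u * e u = e u)
    {d : ℕ} (F : AdaptedFamily K J e d)
    (h : ∃ z ∈ J, ∃ u v, e u * z * e v ∉ Submodule.span K (Set.range F.X)) :
    Nonempty (AdaptedFamily K J e (d + 1)) := by
  classical
  -- an element outside of the span in the deepest possible power of the ideal
  obtain ⟨N, hN⟩ := hJ
  let S : ℕ → Prop := fun t => ∃ z ∈ J ^ (t + 1), ∃ u v,
    e u * z * e v ∉ Submodule.span K (Set.range F.X)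
  have hS0 : S 0 := by simpa [S, Submodule.pow_one] using h
  have hSN : ¬ S N := by
    rintro ⟨z, hz, u, v, hzuv⟩
    rw [Submodule.pow_succ, hN, zero_mul] at hz
    rw [show z = 0 from hz] at hzuv
    simp at hzuv
  obtain ⟨t, ht, ht'⟩ : ∃ t, S t ∧ ¬ S (t + 1) := by
    by_contra hcon
    push Not at hcon
    exact hSN (Nat.rec hS0 (fun t ih => hcon t ih) N)
  obtain ⟨z, hz, u, v, hzuv⟩ := ht
  have hdeep : ∀ w ∈ J ^ (t + 2), ∀ u v, e u * w * e v ∈ Submodule.span K (Set.range F.X) := by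
    intro w hw u v
    by_contra hcon
    exact ht' ⟨w, hw, u, v, hcon⟩
  have hzJ : z ∈ J := by
    have := Ideal.pow_le_self (I := J) (Nat.succ_ne_zero t)
    exact this hz
  set x := e u * z * e v with hx
  let X' : Fin (d + 1) → R := Fin.snoc F.X x
  have hcast : ∀ k : Fin d, X' k.castSucc = F.X k := fun k => by simp [X']
  have hlast : X' (Fin.last d) = x := by simp [X']
  have himg : ∀ k : Fin d, X' '' Set.Iio k.castSucc = F.X '' Set.Iio k := by
    intro k
    ext y
    constructor
    · rintro ⟨l, hl, rfl⟩
      have hl' : (l : ℕ) < k := hl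
      refine ⟨⟨l, hl'.trans k.2⟩, hl', ?_⟩
      rw [← hcast]
      rfl
    · rintro ⟨l, hl, rfl⟩
      exact ⟨l.castSucc, hl, hcast l⟩
  have himg' : X' '' Set.Iio (Fin.last d) = Set.range F.X := by
    ext y
    constructor
    · rintro ⟨l, hl, rfl⟩
      have hl' : (l : ℕ) < d := hl
      refine ⟨⟨l, hl'⟩, ?_⟩
      rw [← hcast]
      rfl
    · rintro ⟨l, rfl⟩
      exact ⟨l.castSucc, l.2, hcast l⟩
  refine ⟨{
    X := X'
    tgt := Fin.snoc F.tgt u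
    src := Fin.snoc F.src v
    mem := ?_
    e_mul_X := ?_
    X_mul_e := ?_
    linearIndependent := ?_
    mul_X_mem := ?_
    X_mul_mem := ?_ }⟩
  · intro k
    refine Fin.lastCases ?_ (fun k => ?_) k
    · rw [hlast]
      exact J.mul_mem_right _ (J.mul_mem_left _ hzJ)
    · rw [hcast]
      exact F.mem k
  · intro k
    refine Fin.lastCases ?_ (fun k => ?_) k
    · rw [hlast, Fin.snoc_last, hx, ← mul_assoc, ← mul_assoc, he]
    · rw [hcast, Fin.snoc_castSucc]
      exact F.e_mul_X k
  · intro k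
    refine Fin.lastCases ?_ (fun k => ?_) k
    · rw [hlast, Fin.snoc_last, hx, mul_assoc, he]
    · rw [hcast, Fin.snoc_castSucc]
      exact F.X_mul_e k
  · exact linearIndependent_finSnoc.2 ⟨F.linearIndependent, hzuv⟩
  · intro k w y hy
    refine Fin.lastCases ?_ (fun k => ?_) k
    · rw [hlast, himg', hx, show e w * y * (e u * z * e v) = e w * ((y * e u) * z) * e v by
        simp only [mul_assoc]]
      refine hdeep _ ?_ w v
      rw [Ideal.IsTwoSided.pow_succ]
      exact Ideal.mul_mem_mul (J.mul_mem_right _ hy) hz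
    · rw [hcast, himg]
      exact F.mul_X_mem k w y hy
  · intro k w y hy
    refine Fin.lastCases ?_ (fun k => ?_) k
    · rw [hlast, himg', hx, show e u * z * e v * y * e w = e u * (z * (e v * y)) * e w by
        simp only [mul_assoc]]
      refine hdeep _ ?_ u w
      rw [Submodule.pow_succ]
      exact Ideal.mul_mem_mul hz (J.mul_mem_left _ hy)
    · rw [hcast, himg]
      exact F.X_mul_mem k w y hy

theorem exists_spanning [FiniteDimensional K R] [J.IsTwoSided] (hJ : IsNilpotent J) {e : Λ → R}
    (he : ∀ u, e u * e u = e u) : ∃ (d : ℕ) (F : AdaptedFamily K J e d),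
      ∀ z ∈ J, ∀ u v, e u * z * e v ∈ Submodule.span K (Set.range F.X) := by
  by_contra hcon
  push Not at hcon
  have : ∀ d, Nonempty (AdaptedFamily K J e d) := by
    intro d
    induction d with
    | zero => exact ⟨⟨Fin.elim0, Fin.elim0, Fin.elim0, fun k => k.elim0, fun k => k.elim0,
        fun k => k.elim0, linearIndependent_empty_type, fun k => k.elim0, fun k => k.elim0⟩⟩
    | succ d ih =>
      obtain ⟨F⟩ := ih
      exact F.exists_succ hJ he (hcon d F)
  obtain ⟨F⟩ := this (Module.finrank K R + 1)
  have := F.linearIndependent.fintype_card_le_finrank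
  simp at this

end AdaptedFamily

namespace PeirceDecomposition

variable {K R Λ : Type*} [Field K] [Ring R] [Algebra K R] {J : Ideal R} [Fintype Λ]
  [DecidableEq Λ] {n : Λ → ℕ} (P : PeirceDecomposition K J n)

theorem e_mul_self (u : Λ) : P.e u * P.e u = P.e u := by simp [P.e_mul_e]

theorem φ_corner (u : Λ) (z : R) : P.φ u (P.e u * z * P.e u) = P.φ u z := by
  have := P.φ_mem u _ (P.sub_mem u z)
  rw [map_sub, map_smul, P.φ_e, smul_eq_mul, mul_one, sub_eq_zero] at this
  exact this

theorem φ_e_of_ne {u v : Λ} (h : u ≠ v) : P.φ u (P.e v) = 0 := by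
  rw [← P.φ_corner, P.e_mul_e, if_neg h, zero_mul, map_zero]

theorem sub_ite_mem (u v : Λ) (z : R) :
    P.e u * z * P.e v - (if u = v then P.φ u z else 0) • P.e u ∈ J := by
  by_cases h : u = v
  · subst h
    simpa using P.sub_mem u z
  · simpa [h] using P.mem_of_ne u v z h

end PeirceDecomposition

/-! ### Peirce coordinates -/

/-- An adapted basis of the Peirce components of `J` together with dual functionals, which vanish on
the idempotents and on all other Peirce components. -/
structure PeirceCoordinates (K : Type*) {R : Type*} [Field K] [Ring R] [Algebra K R]
    {J : Ideal R} {Λ : Type*} [Fintype Λ] [DecidableEq Λ] {n : Λ → ℕ}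
    (P : PeirceDecomposition K J n) (d : ℕ) extends AdaptedFamily K J P.e d where
  ξ : Fin d → R →ₗ[K] K
  ξ_X : ∀ k l, ξ k (X l) = if k = l then 1 else 0
  ξ_e : ∀ k u, ξ k (P.e u) = 0
  ξ_corner : ∀ k z, ξ k (P.e (tgt k) * z * P.e (src k)) = ξ k z
  expand : ∀ u v z, P.e u * z * P.e v =
    (if u = v then P.φ u z else 0) • P.e u + ∑ k, ξ k (P.e u * z * P.e v) • X k

theorem PeirceDecomposition.exists_peirceCoordinates {K R Λ : Type*} [Field K] [Ring R]
    [Algebra K R] [FiniteDimensional K R] {J : Ideal R} [J.IsTwoSided] (hJ : IsNilpotent J)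
    [Fintype Λ] [DecidableEq Λ] {n : Λ → ℕ} (P : PeirceDecomposition K J n) :
    ∃ d, Nonempty (PeirceCoordinates K P d) := by
  classical
  obtain ⟨d, F, hF⟩ := AdaptedFamily.exists_spanning hJ P.e_mul_self (K := K)
  have hdual : ∀ k, ∃ f : R →ₗ[K] K, ∀ l, f (F.X l) = if k = l then 1 else 0 := by
    intro k
    let b := Module.Basis.span F.linearIndependent
    obtain ⟨f, hf⟩ := LinearMap.exists_extend (b.coord k)
    refine ⟨f, fun l => ?_⟩
    have h1 : F.X l = (b l : R) :=
      (congrArg Subtype.val (Module.Basis.span_apply F.linearIndependent l)).symm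
    have h2 := DFunLike.congr_fun hf (b l)
    simp only [LinearMap.comp_apply, Submodule.subtype_apply, Module.Basis.coord_apply,
      Module.Basis.repr_self] at h2
    rw [h1, h2, Finsupp.single_apply]
    simp only [eq_comm]
  choose f hf using hdual
  -- correct the dual functionals so that they vanish on the idempotents
  let g : Fin d → R →ₗ[K] K := fun k => f k - ∑ u, f k (P.e u) • P.φ u
  have gX : ∀ k l, g k (F.X l) = if k = l then 1 else 0 := by
    intro k l
    simp [g, hf, P.φ_mem _ _ (F.mem l)]
  have ge : ∀ k u, g k (P.e u) = 0 := by
    intro k u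
    simp only [g, LinearMap.sub_apply, LinearMap.sum_apply, LinearMap.smul_apply, smul_eq_mul]
    rw [Finset.sum_eq_single u, P.φ_e, mul_one, sub_self]
    · intro v _ hv
      rw [P.φ_e_of_ne hv, mul_zero]
    · simp
  let ξ : Fin d → R →ₗ[K] K := fun k => g k ∘ₗ
    (LinearMap.mulLeft K (P.e (F.tgt k)) ∘ₗ LinearMap.mulRight K (P.e (F.src k)))
  have ξ_apply : ∀ k z, ξ k z = g k (P.e (F.tgt k) * z * P.e (F.src k)) := by
    intro k z
    simp [ξ, mul_assoc]
  have ξX : ∀ k l, ξ k (F.X l) = if k = l then 1 else 0 := by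
    intro k l
    rw [ξ_apply]
    by_cases hkl : k = l
    · subst hkl
      rw [F.e_mul_X, F.X_mul_e, gX]
    · rw [if_neg hkl, ← F.e_mul_X l, ← mul_assoc, P.e_mul_e]
      split_ifs with h1
      · rw [h1, F.e_mul_X, ← F.X_mul_e l, mul_assoc, P.e_mul_e]
        split_ifs with h2
        · rw [F.X_mul_e, gX, if_neg hkl]
        · rw [mul_zero, map_zero]
      · rw [zero_mul, zero_mul, map_zero]
  have ξe : ∀ k u, ξ k (P.e u) = 0 := by
    intro k u
    rw [ξ_apply, P.e_mul_e]
    split_ifs with h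
    · rw [P.e_mul_e]
      split_ifs with h'
      · exact ge k _
      · exact map_zero _
    · rw [zero_mul, map_zero]
  refine ⟨d, ⟨{ F with
    ξ := ξ
    ξ_X := ξX
    ξ_e := ξe
    ξ_corner := fun k z => ?_
    expand := fun u v z => ?_ }⟩⟩
  · rw [ξ_apply, ξ_apply]
    congr 1
    rw [← mul_assoc, ← mul_assoc, P.e_mul_self, mul_assoc, P.e_mul_self]
  · set c := if u = v then P.φ u z else 0 with hc
    have hmem := P.sub_ite_mem u v z
    rw [← hc] at hmem
    have hspan := hF _ hmem u v
    have heq : P.e u * (P.e u * z * P.e v - c • P.e u) * P.e v =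
        P.e u * z * P.e v - c • P.e u := by
      have h1 : c • (P.e u * P.e v) = c • P.e u := by
        by_cases h : u = v
        · subst h; rw [P.e_mul_self]
        · simp [hc, h]
      rw [mul_sub, sub_mul, ← mul_assoc, ← mul_assoc, P.e_mul_self, mul_assoc (P.e u * z),
        P.e_mul_self, mul_smul_comm, smul_mul_assoc, P.e_mul_self, h1]
    rw [heq] at hspan
    obtain ⟨a, ha⟩ := (Submodule.mem_span_range_iff_exists_fun K).1 hspan
    have hξ : ∀ k, ξ k (P.e u * z * P.e v) = a k := by
      intro k
      rw [← sub_add_cancel (P.e u * z * P.e v) (c • P.e u), ← ha, map_add, map_smul, ξe,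
        smul_zero, add_zero, map_sum]
      simp [ξX]
    simp only [hξ]
    rw [ha]
    abel

namespace PeirceCoordinates

variable {K R Λ : Type*} [Field K] [Ring R] [Algebra K R] {J : Ideal R} [Fintype Λ]
  [DecidableEq Λ] {n : Λ → ℕ} {P : PeirceDecomposition K J n} {d : ℕ}
  (C : PeirceCoordinates K P d)

theorem ξ_eq_zero_of_mem_span {k l : Fin d} {z : R}
    (hz : z ∈ Submodule.span K (C.X '' Set.Iio l)) (hkl : ¬ k < l) : C.ξ k z = 0 := by
  induction hz using Submodule.span_induction with
  | mem z h =>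
    obtain ⟨i, hi, rfl⟩ := h
    rw [C.ξ_X, if_neg]
    rintro rfl
    exact hkl hi
  | zero => exact map_zero _
  | add x y _ _ hx hy => rw [map_add, hx, hy, add_zero]
  | smul a x _ hx => rw [map_smul, hx, smul_zero]

theorem ξ_eq_zero_of_tgt_ne {k : Fin d} {u : Λ} (h : C.tgt k ≠ u) (z : R) :
    C.ξ k (P.e u * z) = 0 := by
  rw [← C.ξ_corner, ← mul_assoc, P.e_mul_e, if_neg h, zero_mul, zero_mul, map_zero]

theorem ξ_eq_zero_of_src_ne {k : Fin d} {u : Λ} (h : C.src k ≠ u) (z : R) :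
    C.ξ k (z * P.e u) = 0 := by
  rw [← C.ξ_corner, mul_assoc, mul_assoc, P.e_mul_e, if_neg h.symm, mul_zero, mul_zero, map_zero]

theorem X_mul_X_of_ne {i j : Fin d} (h : C.src i ≠ C.tgt j) : C.X i * C.X j = 0 := by
  rw [← C.X_mul_e i, ← C.e_mul_X j, mul_assoc, ← mul_assoc (P.e _), P.e_mul_e, if_neg h,
    zero_mul, mul_zero]

theorem X_mul_X [J.IsTwoSided] (i j : Fin d) :
    C.X i * C.X j = ∑ k, C.ξ k (C.X i * C.X j) • C.X k := by
  have h : P.e (C.tgt i) * (C.X i * C.X j) * P.e (C.src j) = C.X i * C.X j := by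
    rw [← mul_assoc, C.e_mul_X, mul_assoc, C.X_mul_e]
  have := C.expand (C.tgt i) (C.src j) (C.X i * C.X j)
  rwa [h, P.φ_mem _ _ (J.mul_mem_left _ (C.mem j)), ite_self, zero_smul, zero_add] at this

/-- The structure constants of the adapted basis. -/
def labelledConstants [J.IsTwoSided] : LabelledConstants K Λ d where
  tgt := C.tgt
  src := C.src
  c i j k := C.ξ k (C.X i * C.X j)
  lt_left {i j k} h := by
    by_contra hlt
    refine h (C.ξ_eq_zero_of_mem_span (l := i) ?_ hlt)
    rw [← C.X_mul_e j, ← mul_assoc]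
    exact C.X_mul_mem i _ _ (C.mem j)
  lt_right {i j k} h := by
    by_contra hlt
    refine h (C.ξ_eq_zero_of_mem_span (l := j) ?_ hlt)
    rw [← C.e_mul_X i]
    exact C.mul_X_mem j _ _ (C.mem i)
  src_eq_tgt {i j k} h := by
    by_contra hne
    exact h (by rw [C.X_mul_X_of_ne hne, map_zero])
  tgt_eq {i j k} h := by
    by_contra hne
    refine h ?_
    rw [← C.e_mul_X i, mul_assoc]
    exact C.ξ_eq_zero_of_tgt_ne hne _
  src_eq {i j k} h := by
    by_contra hne
    refine h ?_
    rw [← C.X_mul_e j, ← mul_assoc]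
    exact C.ξ_eq_zero_of_src_ne hne _
  assoc i j m k := by
    have h1 := congrArg (fun z => C.ξ k (z * C.X m)) (C.X_mul_X i j)
    have h2 := congrArg (fun z => C.ξ k (C.X i * z)) (C.X_mul_X j m)
    simp only [Finset.sum_mul, Finset.mul_sum, smul_mul_assoc, mul_smul_comm, map_sum, map_smul,
      smul_eq_mul] at h1 h2
    rw [← h1, ← h2, mul_assoc]

/-- The functionals `ξ k` on a product of two elements of Peirce components. -/
theorem ξ_mul [J.IsTwoSided] (k : Fin d) (w : Λ) (g g' : R) (hg : P.e (C.tgt k) * g * P.e w = g)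
    (hg' : P.e w * g' * P.e (C.src k) = g') :
    C.ξ k (g * g') = (if C.tgt k = w then P.φ (C.tgt k) g else 0) * C.ξ k g' +
      (if w = C.src k then P.φ w g' else 0) * C.ξ k g +
      ∑ i, ∑ j, C.labelledConstants.c i j k * (C.ξ i g * C.ξ j g') := by
  have h1 := C.expand (C.tgt k) w g
  have h2 := C.expand w (C.src k) g'
  rw [hg] at h1
  rw [hg'] at h2
  set a := if C.tgt k = w then P.φ (C.tgt k) g else 0 with ha
  set b := if w = C.src k then P.φ w g' else 0 with hb
  have ew : g * P.e w = g := by rw [← hg, mul_assoc, P.e_mul_self]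
  have hag : a • (P.e (C.tgt k) * g') = a • g' := by
    by_cases h : C.tgt k = w
    · rw [h, ← hg', ← mul_assoc, ← mul_assoc, P.e_mul_self]
    · simp [ha, h]
  have hN : ∑ i, C.ξ i g • C.X i = g - a • P.e (C.tgt k) := by
    rw [eq_sub_iff_add_eq, add_comm]
    exact h1.symm
  have e1 : g * g' = a • g' + (∑ i, C.ξ i g • C.X i) * g' := by
    conv_lhs => rw [h1]
    rw [add_mul, smul_mul_assoc, hag]
  have e2 : (∑ i, C.ξ i g • C.X i) * g' = b • (g - a • (P.e (C.tgt k) * P.e w)) +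
      ∑ i, ∑ j, (C.ξ i g * C.ξ j g') • (C.X i * C.X j) := by
    conv_lhs => rw [h2]
    rw [mul_add, mul_smul_comm]
    congr 1
    · rw [hN, sub_mul, ew, smul_mul_assoc]
    · rw [Finset.sum_mul_sum]
      refine Finset.sum_congr rfl fun i _ => Finset.sum_congr rfl fun j _ => ?_
      rw [smul_mul_smul_comm]
  have e3 : C.ξ k (P.e (C.tgt k) * P.e w) = 0 := by
    rw [P.e_mul_e]
    split_ifs
    · exact C.ξ_e _ _
    · exact map_zero _
  rw [e1, e2]
  simp only [map_add, map_smul, map_sub, e3, smul_eq_mul, mul_zero, sub_zero, map_sum]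
  rw [← add_assoc]
  congr 1
  refine Finset.sum_congr rfl fun i _ => Finset.sum_congr rfl fun j _ => ?_
  rw [mul_comm]
  rfl

end PeirceCoordinates

theorem Finset.sum_sum_sum_mul_ite {ι K : Type*} [Fintype ι] [DecidableEq ι] [Field K]
    (N M : ι → ℕ) (f : ι → ℕ → ℕ → K) {u : ι} {a b : ℕ} (ha : a < N u) (hb : b < M u) :
    ∑ v, ∑ a' ∈ Finset.range (N v), ∑ b' ∈ Finset.range (M v),
      f v a' b' * (if v = u ∧ a' = a ∧ b' = b then 1 else 0) = f u a b := by
  rw [Finset.sum_eq_single u, Finset.sum_eq_single a, Finset.sum_eq_single b]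
  · simp
  · intro b' _ h; simp [h]
  · intro h; exact absurd (Finset.mem_range.2 hb) h
  · intro a' _ h; simp [h]
  · intro h; exact absurd (Finset.mem_range.2 ha) h
  · intro v _ h; simp [h]
  · simp

namespace PeirceDecomposition

variable {K R Λ : Type*} [Field K] [Ring R] [Algebra K R] {J : Ideal R} [Fintype Λ]
  [DecidableEq Λ] {n : Λ → ℕ} (P : PeirceDecomposition K J n)

/-- The entry at the position `(a, b)` of the block `(u, v)`, as an element of `e u * R * e v`. -/
def cut (u v : Λ) (a b : ℕ) : R →ₗ[K] R :=
  LinearMap.mulLeft K (P.p u a) ∘ₗ LinearMap.mulRight K (P.q v b)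

theorem cut_apply (u v : Λ) (a b : ℕ) (z : R) : P.cut u v a b z = P.p u a * z * P.q v b := by
  simp [cut, mul_assoc]

theorem cut_mul (u v : Λ) (a b : ℕ) (z z' : R) : P.cut u v a b (z * z') =
    ∑ w, ∑ c ∈ Finset.range (n w), P.cut u w a c z * P.cut w v c b z' := by
  have : P.cut u v a b (z * z') =
      P.p u a * z * (∑ w, ∑ c ∈ Finset.range (n w), P.q w c * P.p w c) * z' * P.q v b := by
    rw [P.sum_q_mul_p, cut_apply, mul_one]
    simp only [mul_assoc]
  rw [this]
  simp only [Finset.mul_sum, Finset.sum_mul, cut_apply, mul_assoc]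

theorem e_mul_cut {u v : Λ} {a b : ℕ} (ha : a < n u) (z : R) :
    P.e u * P.cut u v a b z = P.cut u v a b z := by
  rw [cut_apply, ← mul_assoc, ← mul_assoc, P.e_mul_p u a ha]

theorem cut_mul_e {u v : Λ} {a b : ℕ} (hb : b < n v) (z : R) :
    P.cut u v a b z * P.e v = P.cut u v a b z := by
  rw [cut_apply, mul_assoc, P.q_mul_e v b hb]

theorem sum_cut (z : R) : z = ∑ u, ∑ a ∈ Finset.range (n u), ∑ v, ∑ b ∈ Finset.range (n v),
    P.q u a * P.cut u v a b z * P.p v b := by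
  have : z = (∑ u, ∑ a ∈ Finset.range (n u), P.q u a * P.p u a) * z *
      ∑ v, ∑ b ∈ Finset.range (n v), P.q v b * P.p v b := by
    rw [P.sum_q_mul_p, one_mul, mul_one]
  conv_lhs => rw [this]
  simp only [Finset.sum_mul, cut_apply, mul_assoc]
  simp only [Finset.mul_sum]

theorem cut_q_mul_p {u v w : Λ} {a b a' b' : ℕ} (ha : a < n u) (hb : b < n w) (ha' : a' < n v)
    (hb' : b' < n v) : P.cut u w a b (P.q v a' * P.p v b') =
      if v = u ∧ v = w ∧ a' = a ∧ b' = b then P.e u else 0 := by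
  rw [cut_apply, ← mul_assoc, mul_assoc, P.p_mul_q u v a a' ha ha', P.p_mul_q v w b' b hb' hb]
  by_cases h1 : u = v ∧ a = a'
  · obtain ⟨rfl, rfl⟩ := h1
    by_cases h2 : u = w ∧ b' = b
    · obtain ⟨rfl, rfl⟩ := h2
      simp [P.e_mul_self]
    · rw [if_neg h2, mul_zero, if_neg]
      tauto
  · rw [if_neg h1, zero_mul, if_neg]
    rintro ⟨rfl, -, rfl, -⟩
    exact h1 ⟨rfl, rfl⟩

theorem φ_mul [J.IsTwoSided] {u w : Λ} {g g' : R} (hg : P.e u * g * P.e w = g)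
    (hg' : P.e w * g' = g') : P.φ u (g * g') = if u = w then P.φ u g * P.φ u g' else 0 := by
  have h := P.sub_ite_mem u w g
  rw [hg] at h
  have h0 := P.φ_mem u _ (J.mul_mem_right g' h)
  rw [sub_mul, map_sub, sub_eq_zero] at h0
  rw [h0, smul_mul_assoc, map_smul, smul_eq_mul]
  by_cases huw : u = w
  · subst huw
    simp [hg']
  · simp [huw]

/-- The matrix entries of the image in the factor `u` modulo `J`. -/
def diagCoord (u : Λ) (a b : ℕ) : R →ₗ[K] K := P.φ u ∘ₗ P.cut u u a b

theorem diagCoord_mul [J.IsTwoSided] {u : Λ} {a : ℕ} (ha : a < n u) (b : ℕ) (z z' : R) :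
    P.diagCoord u a b (z * z') =
      ∑ c ∈ Finset.range (n u), P.diagCoord u a c z * P.diagCoord u c b z' := by
  rw [diagCoord, LinearMap.comp_apply, P.cut_mul, map_sum, Finset.sum_eq_single u]
  · rw [map_sum]
    refine Finset.sum_congr rfl fun c hc => ?_
    have hc := Finset.mem_range.1 hc
    rw [P.φ_mul (w := u) (by rw [P.e_mul_cut ha, P.cut_mul_e hc]) (P.e_mul_cut hc z'), if_pos rfl]
    rfl
  · intro w _ hw
    rw [map_sum]
    refine Finset.sum_eq_zero fun c hc => ?_
    have hc := Finset.mem_range.1 hc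
    rw [P.φ_mul (w := w) (by rw [P.e_mul_cut ha, P.cut_mul_e hc]) (P.e_mul_cut hc z'),
      if_neg hw.symm]
  · simp

theorem mem_iff_diagCoord [J.IsTwoSided] (z : R) :
    z ∈ J ↔ ∀ u a b, a < n u → b < n u → P.diagCoord u a b z = 0 := by
  constructor
  · intro hz u a b _ _
    rw [diagCoord, LinearMap.comp_apply, P.cut_apply]
    exact P.φ_mem u _ (J.mul_mem_right _ (J.mul_mem_left _ hz))
  · intro h
    rw [P.sum_cut z]
    refine sum_mem fun u _ => sum_mem fun a ha => sum_mem fun v _ => sum_mem fun b hb =>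
      J.mul_mem_right _ (J.mul_mem_left _ ?_)
    have ha := Finset.mem_range.1 ha
    have hb := Finset.mem_range.1 hb
    have hmem := P.sub_ite_mem u v (P.cut u v a b z)
    rw [P.e_mul_cut ha, P.cut_mul_e hb] at hmem
    have h0 : (if u = v then P.φ u (P.cut u v a b z) else 0) = 0 := by
      split_ifs with huv
      · subst huv
        exact h u a b ha hb
      · rfl
    rwa [h0, zero_smul, sub_zero] at hmem

/-- A character of `R` that vanishes on `J` is the projection to a factor of size one. -/
theorem exists_eq_φ_of_algHom (hn : ∀ u, 0 < n u) (χ : R →ₐ[K] K) (hχ : ∀ z ∈ J, χ z = 0) :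
    ∃ u, n u = 1 ∧ ∀ z, χ z = P.φ u z := by
  have hqp : ∀ u a, a < n u → χ (P.q u a * P.p u a) = χ (P.e u) := by
    intro u a ha
    rw [map_mul, mul_comm, ← map_mul, P.p_mul_q u u a a ha ha]
    simp
  obtain ⟨u, hu⟩ : ∃ u, χ (P.e u) ≠ 0 := by
    by_contra hcon
    push Not at hcon
    have h1 : χ 1 = 0 := by
      rw [← P.sum_q_mul_p, map_sum]
      refine Finset.sum_eq_zero fun u _ => ?_
      rw [map_sum]
      exact Finset.sum_eq_zero fun a ha => by rw [hqp u a (Finset.mem_range.1 ha), hcon]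
    simp at h1
  have h1 : χ (P.e u) = 1 := by
    have : χ (P.e u) * χ (P.e u) = χ (P.e u) := by rw [← map_mul, P.e_mul_self]
    exact mul_right_cancel₀ hu (by rw [this, one_mul])
  refine ⟨u, le_antisymm ?_ (hn u), fun z => ?_⟩
  · by_contra hlt
    push Not at hlt
    have h0 : χ (P.q u 0 * P.p u 0) * χ (P.q u 1 * P.p u 1) = 0 := by
      rw [← map_mul, mul_assoc, ← mul_assoc (P.p u 0),
        P.p_mul_q u u 0 1 (hn u) hlt, if_neg (by simp), zero_mul, mul_zero, map_zero]
    rw [hqp u 0 (hn u), hqp u 1 hlt, h1] at h0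
    simp at h0
  · have := hχ _ (P.sub_mem u z)
    rw [map_sub, map_smul, map_mul, map_mul, h1, sub_eq_zero] at this
    simpa using this

end PeirceDecomposition

namespace PeirceCoordinates

variable {K R Λ : Type*} [Field K] [Ring R] [Algebra K R] {J : Ideal R} [Fintype Λ]
  [DecidableEq Λ] {n : Λ → ℕ} {P : PeirceDecomposition K J n} {d : ℕ}
  (C : PeirceCoordinates K P d)

/-- The matrix entries that belong to the basis element `X k`. -/
def coord (k : Fin d) (a b : ℕ) : R →ₗ[K] K := C.ξ k ∘ₗ P.cut (C.tgt k) (C.src k) a b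

theorem coord_mul [J.IsTwoSided] {k : Fin d} {a b : ℕ} (ha : a < n (C.tgt k)) (hb : b < n (C.src k))
    (z z' : R) : C.coord k a b (z * z') =
      ∑ c ∈ Finset.range (n (C.tgt k)), P.diagCoord (C.tgt k) a c z * C.coord k c b z' +
      ∑ c ∈ Finset.range (n (C.src k)), C.coord k a c z * P.diagCoord (C.src k) c b z' +
      ∑ i, ∑ j, C.labelledConstants.c i j k *
        ∑ c ∈ Finset.range (n (C.src i)), C.coord i a c z * C.coord j c b z' := by
  have h : ∀ w, ∀ c ∈ Finset.range (n w),
      C.ξ k (P.cut (C.tgt k) w a c z * P.cut w (C.src k) c b z') =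
      (if C.tgt k = w then P.φ (C.tgt k) (P.cut (C.tgt k) w a c z) else 0) *
        C.ξ k (P.cut w (C.src k) c b z') +
      (if w = C.src k then P.φ w (P.cut w (C.src k) c b z') else 0) *
        C.ξ k (P.cut (C.tgt k) w a c z) +
      ∑ i, ∑ j, C.labelledConstants.c i j k *
        (C.ξ i (P.cut (C.tgt k) w a c z) * C.ξ j (P.cut w (C.src k) c b z')) := by
    intro w c hc
    have hc := Finset.mem_range.1 hc
    exact C.ξ_mul k w _ _ (by rw [P.e_mul_cut ha, P.cut_mul_e hc])
      (by rw [P.e_mul_cut hc, P.cut_mul_e hb])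
  rw [coord, LinearMap.comp_apply, P.cut_mul, map_sum]
  simp only [map_sum]
  rw [Finset.sum_congr rfl fun w _ => Finset.sum_congr rfl (h w)]
  simp only [Finset.sum_add_distrib]
  congr 1
  · congr 1
    · rw [Finset.sum_eq_single (C.tgt k)]
      · exact Finset.sum_congr rfl fun c _ => by rw [if_pos rfl]; rfl
      · intro w _ hw
        exact Finset.sum_eq_zero fun c _ => by rw [if_neg hw.symm, zero_mul]
      · simp
    · rw [Finset.sum_eq_single (C.src k)]
      · exact Finset.sum_congr rfl fun c _ => by rw [if_pos rfl, mul_comm]; rfl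
      · intro w _ hw
        exact Finset.sum_eq_zero fun c _ => by rw [if_neg hw, zero_mul]
      · simp
  · have h3 : ∀ i j, ∑ w, ∑ c ∈ Finset.range (n w), C.labelledConstants.c i j k *
        (C.ξ i (P.cut (C.tgt k) w a c z) * C.ξ j (P.cut w (C.src k) c b z')) =
        C.labelledConstants.c i j k *
          ∑ c ∈ Finset.range (n (C.src i)), C.coord i a c z * C.coord j c b z' := by
      intro i j
      by_cases hne : C.labelledConstants.c i j k = 0
      · simp [hne]
      have h1 : C.src i = C.tgt j := C.labelledConstants.src_eq_tgt hne
      have h2 : C.tgt k = C.tgt i := C.labelledConstants.tgt_eq hne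
      have h3 : C.src k = C.src j := C.labelledConstants.src_eq hne
      rw [Finset.sum_eq_single (C.src i), Finset.mul_sum]
      · refine Finset.sum_congr rfl fun c _ => ?_
        simp only [coord, LinearMap.comp_apply]
        rw [h2, h3, ← h1]
      · intro w _ hw
        refine Finset.sum_eq_zero fun c hc => ?_
        rw [← P.cut_mul_e (Finset.mem_range.1 hc), C.ξ_eq_zero_of_src_ne hw.symm, zero_mul,
          mul_zero]
      · simp
    simp only [← h3]
    have : ∀ w, ∑ c ∈ Finset.range (n w), ∑ i, ∑ j, C.labelledConstants.c i j k *
        (C.ξ i (P.cut (C.tgt k) w a c z) * C.ξ j (P.cut w (C.src k) c b z')) =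
        ∑ i, ∑ j, ∑ c ∈ Finset.range (n w), C.labelledConstants.c i j k *
        (C.ξ i (P.cut (C.tgt k) w a c z) * C.ξ j (P.cut w (C.src k) c b z')) := by
      intro w
      rw [Finset.sum_comm]
      exact Finset.sum_congr rfl fun i _ => Finset.sum_comm
    rw [Finset.sum_congr rfl fun w _ => this w, Finset.sum_comm]
    exact Finset.sum_congr rfl fun i _ => Finset.sum_comm

theorem eq_zero_of_coord {z : R}
    (h : ∀ u a b, a < n u → b < n u → P.diagCoord u a b z = 0)
    (h' : ∀ k a b, a < n (C.tgt k) → b < n (C.src k) → C.coord k a b z = 0) : z = 0 := by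
  rw [P.sum_cut z]
  refine Finset.sum_eq_zero fun u _ => Finset.sum_eq_zero fun a ha => Finset.sum_eq_zero fun v _ =>
    Finset.sum_eq_zero fun b hb => ?_
  have ha := Finset.mem_range.1 ha
  have hb := Finset.mem_range.1 hb
  have hex := C.expand u v (P.cut u v a b z)
  rw [P.e_mul_cut ha, P.cut_mul_e hb] at hex
  have h0 : (if u = v then P.φ u (P.cut u v a b z) else 0) = 0 := by
    split_ifs with huv
    · subst huv
      exact h u a b ha hb
    · rfl
  have h1 : ∀ k, C.ξ k (P.cut u v a b z) = 0 := by
    intro k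
    by_cases hu : C.tgt k = u
    · by_cases hv : C.src k = v
      · subst hu hv
        exact h' k a b ha hb
      · rw [← P.cut_mul_e hb]
        exact C.ξ_eq_zero_of_src_ne hv _
    · rw [← P.e_mul_cut ha]
      exact C.ξ_eq_zero_of_tgt_ne hu _
  rw [h0, zero_smul, zero_add, Finset.sum_eq_zero fun k _ => by rw [h1, zero_smul]] at hex
  rw [hex, mul_zero, zero_mul]

theorem cut_q_mul_X_mul_p {u v : Λ} {i : Fin d} {a b a' b' : ℕ} (ha : a < n u) (hb : b < n v)
    (ha' : a' < n (C.tgt i)) (hb' : b' < n (C.src i)) :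
    P.cut u v a b (P.q (C.tgt i) a' * C.X i * P.p (C.src i) b') =
      if C.tgt i = u ∧ C.src i = v ∧ a' = a ∧ b' = b then C.X i else 0 := by
  rw [P.cut_apply, show P.p u a * (P.q (C.tgt i) a' * C.X i * P.p (C.src i) b') * P.q v b =
    (P.p u a * P.q (C.tgt i) a') * C.X i * (P.p (C.src i) b' * P.q v b) by
      simp only [mul_assoc], P.p_mul_q _ _ _ _ ha ha', P.p_mul_q _ _ _ _ hb' hb]
  by_cases h1 : u = C.tgt i ∧ a = a'
  · obtain ⟨rfl, rfl⟩ := h1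
    by_cases h2 : C.src i = v ∧ b' = b
    · obtain ⟨rfl, rfl⟩ := h2
      simp [C.e_mul_X, C.X_mul_e]
    · rw [if_neg h2, mul_zero, if_neg]
      tauto
  · rw [if_neg h1, zero_mul, zero_mul, if_neg]
    rintro ⟨rfl, -, rfl, -⟩
    exact h1 ⟨rfl, rfl⟩

theorem exists_coord_eq (f : Λ → ℕ → ℕ → K) (g : Fin d → ℕ → ℕ → K) : ∃ z,
    (∀ u a b, a < n u → b < n u → P.diagCoord u a b z = f u a b) ∧
    (∀ k a b, a < n (C.tgt k) → b < n (C.src k) → C.coord k a b z = g k a b) := by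
  refine ⟨∑ u, ∑ a ∈ Finset.range (n u), ∑ b ∈ Finset.range (n u),
      f u a b • (P.q u a * P.p u b) +
    ∑ k, ∑ a ∈ Finset.range (n (C.tgt k)), ∑ b ∈ Finset.range (n (C.src k)),
      g k a b • (P.q (C.tgt k) a * C.X k * P.p (C.src k) b),
    fun u a b ha hb => ?_, fun k a b ha hb => ?_⟩
  · rw [map_add]
    simp only [map_sum, map_smul, smul_eq_mul]
    rw [← Finset.sum_sum_sum_mul_ite n n f ha hb]
    have h2 : ∑ k, ∑ a' ∈ Finset.range (n (C.tgt k)), ∑ b' ∈ Finset.range (n (C.src k)),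
        g k a' b' * P.diagCoord u a b (P.q (C.tgt k) a' * C.X k * P.p (C.src k) b') = 0 := by
      refine Finset.sum_eq_zero fun k _ => Finset.sum_eq_zero fun a' ha' =>
        Finset.sum_eq_zero fun b' hb' => ?_
      rw [PeirceDecomposition.diagCoord, LinearMap.comp_apply,
        C.cut_q_mul_X_mul_p ha hb (Finset.mem_range.1 ha') (Finset.mem_range.1 hb')]
      split_ifs
      · rw [P.φ_mem _ _ (C.mem k), mul_zero]
      · rw [map_zero, mul_zero]
    rw [h2, add_zero]
    refine Finset.sum_congr rfl fun v _ => Finset.sum_congr rfl fun a' ha' =>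
      Finset.sum_congr rfl fun b' hb' => ?_
    rw [PeirceDecomposition.diagCoord, LinearMap.comp_apply,
      P.cut_q_mul_p ha hb (Finset.mem_range.1 ha') (Finset.mem_range.1 hb')]
    by_cases hc : v = u ∧ a' = a ∧ b' = b
    · rw [if_pos hc, if_pos ⟨hc.1, hc.1, hc.2⟩, P.φ_e]
    · rw [if_neg hc, if_neg fun h => hc ⟨h.1, h.2.2⟩, map_zero]
  · rw [map_add]
    simp only [map_sum, map_smul, smul_eq_mul]
    rw [← Finset.sum_sum_sum_mul_ite (fun k => n (C.tgt k)) (fun k => n (C.src k)) g ha hb]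
    have h1 : ∑ u, ∑ a' ∈ Finset.range (n u), ∑ b' ∈ Finset.range (n u),
        f u a' b' * C.coord k a b (P.q u a' * P.p u b') = 0 := by
      refine Finset.sum_eq_zero fun u _ => Finset.sum_eq_zero fun a' ha' =>
        Finset.sum_eq_zero fun b' hb' => ?_
      rw [coord, LinearMap.comp_apply,
        P.cut_q_mul_p ha hb (Finset.mem_range.1 ha') (Finset.mem_range.1 hb')]
      split_ifs
      · rw [C.ξ_e, mul_zero]
      · rw [map_zero, mul_zero]
    rw [h1, zero_add]
    refine Finset.sum_congr rfl fun l _ => Finset.sum_congr rfl fun a' ha' =>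
      Finset.sum_congr rfl fun b' hb' => ?_
    rw [coord, LinearMap.comp_apply,
      C.cut_q_mul_X_mul_p ha hb (Finset.mem_range.1 ha') (Finset.mem_range.1 hb')]
    by_cases hc : l = k ∧ a' = a ∧ b' = b
    · obtain ⟨rfl, hc⟩ := hc
      rw [if_pos ⟨rfl, rfl, hc⟩, C.ξ_X, if_pos rfl, if_pos ⟨rfl, hc⟩]
    · rw [if_neg hc]
      congr 1
      split_ifs with h
      · rw [C.ξ_X, if_neg]
        rintro rfl
        exact hc ⟨rfl, h.2.2⟩
      · exact map_zero _

end PeirceCoordinates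

/-! ### Algebras without `1` -/

section Unitization

variable (K B : Type*) [Field K] [NonUnitalRing B] [Module K B] [IsScalarTower K B B]
  [SMulCommClass K B B]

theorem fst_eq_zero_of_mem_jacobson [FiniteDimensional K (Unitization K B)]
    {z : Unitization K B} (hz : z ∈ Ring.jacobson (Unitization K B)) : z.fst = 0 := by
  have := IsArtinianRing.of_finite K (Unitization K B)
  obtain ⟨N, hN⟩ := IsSemiprimaryRing.isNilpotent (R := Unitization K B)
  have h0 : z ^ N = 0 := by simpa [hN] using Ideal.pow_mem_pow hz N
  have h1 : (Unitization.fstHom K B z) ^ N = 0 := by rw [← map_pow, h0, map_zero]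
  exact eq_zero_of_pow_eq_zero h1

/-- In the unitization of `B`, the augmentation is the factor with the label `none`. -/
theorem exists_peirceDecomposition_unitization [IsAlgClosed K]
    [FiniteDimensional K (Unitization K B)] :
    ∃ (k : ℕ) (deg : Fin k → ℕ) (P : PeirceDecomposition K (Ring.jacobson (Unitization K B))
      (blockSize deg)), (∀ u, 0 < deg u) ∧ ∀ z, z.fst = P.φ none z := by
  obtain ⟨m, n, hn, ⟨P⟩⟩ := exists_peirceDecomposition K (Unitization K B)
  obtain ⟨i₀, hi₀, hφ⟩ := P.exists_eq_φ_of_algHom hn (Unitization.fstHom K B)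
    fun z hz => fst_eq_zero_of_mem_jacobson K B hz
  obtain ⟨k, rfl⟩ : ∃ k, m = k + 1 := Nat.exists_eq_succ_of_ne_zero (by
    rintro rfl
    exact i₀.elim0)
  let θ : Option (Fin k) ≃ Fin (k + 1) := (finSuccEquiv' i₀).symm
  have hθ : θ none = i₀ := finSuccEquiv'_symm_none i₀
  obtain ⟨n', hn', P', hP'⟩ : ∃ n', n' = blockSize (fun u => n (θ (some u))) ∧
      ∃ P' : PeirceDecomposition K (Ring.jacobson (Unitization K B)) n',
        ∀ z, z.fst = P'.φ none z := by
    refine ⟨n ∘ θ, ?_, P.reindex θ, fun z => ?_⟩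
    · funext o
      cases o with
      | none => exact (congrArg n hθ).trans hi₀
      | some u => rfl
    · change _ = P.φ (θ none) z
      rw [hθ]
      exact hφ z
  subst hn'
  exact ⟨k, _, P', fun u => hn _, hP'⟩

variable {K B} in
/-- If `B` has an identity `e`, then the idempotent of the label `none` is congruent to `1 - e`, which
annihilates the radical, so that no arrow has an end labelled `none`. -/
theorem PeirceCoordinates.ne_none_of_identity [FiniteDimensional K (Unitization K B)] {k : ℕ}
    {deg : Fin k → ℕ}
    {P : PeirceDecomposition K (Ring.jacobson (Unitization K B)) (blockSize deg)}
    (hP : ∀ z, z.fst = P.φ none z) {d : ℕ} (C : PeirceCoordinates K P d)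
    {e : B} (he : ∀ x, e * x = x ∧ x * e = x) (i : Fin d) : C.tgt i ≠ none ∧ C.src i ≠ none := by
  have := IsArtinianRing.of_finite K (Unitization K B)
  let w : Unitization K B := 1 - (e : Unitization K B)
  have hw1 : ∀ x : B, w * (x : Unitization K B) = 0 := by
    intro x
    rw [sub_mul, one_mul, ← Unitization.inr_mul, (he x).1, sub_self]
  have hw2 : ∀ x : B, (x : Unitization K B) * w = 0 := by
    intro x
    rw [mul_sub, mul_one, ← Unitization.inr_mul, (he x).2, sub_self]
  have hdec : ∀ z : Unitization K B, z = algebraMap K _ z.fst + (z.snd : Unitization K B) :=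
    fun z => (Unitization.inl_fst_add_inr_snd_eq z).symm
  have hw3 : ∀ z, w * z = z.fst • w := by
    intro z
    conv_lhs => rw [hdec z]
    rw [mul_add, hw1, add_zero, ← Algebra.commutes, Algebra.smul_def]
  have hw4 : ∀ z, z * w = z.fst • w := by
    intro z
    conv_lhs => rw [hdec z]
    rw [add_mul, hw2, add_zero, Algebra.smul_def]
  have he0 : (P.e none).fst = 1 := by rw [hP, P.φ_e]
  have hsub : ∀ z z' : Unitization K B, (z - z').fst = z.fst - z'.fst :=
    map_sub (Unitization.fstHom K B)
  have hwf : w.fst = 1 := by rw [hsub, Unitization.fst_one, Unitization.fst_inr, sub_zero]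
  have hX : ((C.X i).snd : Unitization K B) = C.X i := by
    conv_rhs => rw [hdec (C.X i), fst_eq_zero_of_mem_jacobson K B (C.mem i), map_zero, zero_add]
  -- the idempotent of the label `none` and `w` differ by a nilpotent element
  have hmem : P.e none - w ∈ Ring.jacobson (Unitization K B) := by
    have h1 := P.sub_mem none (P.e none - w)
    rw [← hP, hsub, he0, hwf, sub_self, zero_smul, sub_zero, mul_sub, sub_mul,
      P.e_mul_self, P.e_mul_self, hw4, he0, one_smul, hw3, he0, one_smul] at h1
    exact h1
  obtain ⟨N, hN⟩ := IsSemiprimaryRing.isNilpotent (R := Unitization K B)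
  have hunit : IsUnit (1 - (P.e none - w)) :=
    IsNilpotent.isUnit_one_sub ⟨N, by simpa [hN] using Ideal.pow_mem_pow hmem N⟩
  have hne := C.linearIndependent.ne_zero i
  constructor
  · intro h
    refine hne (hunit.mul_right_eq_zero.1 ?_)
    have h1 := C.e_mul_X i
    rw [h] at h1
    rw [sub_mul, sub_mul, h1, ← hX, hw1, one_mul, sub_zero, sub_self]
  · intro h
    refine hne (hunit.mul_left_eq_zero.1 ?_)
    have h1 := C.X_mul_e i
    rw [h] at h1
    rw [mul_sub, mul_sub, h1, ← hX, hw2, mul_one, sub_zero, sub_self]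

theorem exists_blockCoordinates [IsAlgClosed K] [FiniteDimensional K B] :
    Nonempty (BlockCoordinates K B) := by
  have : FiniteDimensional K (Unitization K B) :=
    Module.Finite.equiv (Unitization.linearEquiv K K B).symm
  have := IsArtinianRing.of_finite K (Unitization K B)
  obtain ⟨k, deg, P, hdeg, hP⟩ := exists_peirceDecomposition_unitization K B
  obtain ⟨d, ⟨C⟩⟩ := P.exists_peirceCoordinates IsSemiprimaryRing.isNilpotent
  have hφmul : ∀ z z' : Unitization K B, P.φ none (z * z') = P.φ none z * P.φ none z' := by
    intro z z'
    simp only [← hP, Unitization.fst_mul]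
  have hcut : ∀ z : Unitization K B, ∀ a b, P.diagCoord none a b z =
      P.φ none (P.p none a) * z.fst * P.φ none (P.q none b) := by
    intro z a b
    rw [PeirceDecomposition.diagCoord, LinearMap.comp_apply, P.cut_apply, hφmul, hφmul, hP z]
  let y : Option (Fin k) → ℕ → ℕ → B →ₗ[K] K := fun o a b =>
    match o with
    | none => 0
    | some u => P.diagCoord (some u) a b ∘ₗ Unitization.inrHom K K B
  have hy : ∀ o a b z, y o a b z = P.diagCoord o a b (z : Unitization K B) := by
    intro o a b z
    cases o with
    | none => rw [hcut]; simp [y]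
    | some u => rfl
  exact ⟨{
    k := k
    deg := deg
    deg_pos := hdeg
    d := d
    D := C.labelledConstants
    y := y
    x := fun i a b => C.coord i a b ∘ₗ Unitization.inrHom K K B
    y_none := rfl
    y_mul := fun u a b ha _ z z' => by
      simp only [hy, Unitization.inr_mul]
      exact P.diagCoord_mul ha b _ _
    x_mul := fun i a b ha hb z z' => by
      simp only [hy, LinearMap.comp_apply, Unitization.inrHom_apply, Unitization.inr_mul]
      exact C.coord_mul ha hb _ _
    ext := fun z h h' => by
      refine Unitization.inr_injective (R := K) ?_
      rw [Unitization.inr_zero]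
      refine C.eq_zero_of_coord (fun o a b ha hb => ?_) h'
      cases o with
      | none => rw [hcut]; simp
      | some u => exact h u a b ha hb
    exists_eq := fun f g => by
      obtain ⟨z, hz, hz'⟩ := C.exists_coord_eq (fun o => o.elim 0 f) g
      have h0 : z.fst = 0 := by
        have h1 := hz none 0 0 Nat.one_pos Nat.one_pos
        have h2 := congrArg (P.φ none) (P.p_mul_q none none 0 0 Nat.one_pos Nat.one_pos)
        rw [if_pos ⟨rfl, rfl⟩, hφmul, P.φ_e] at h2
        rw [hcut, mul_right_comm, h2, one_mul] at h1
        exact h1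
      have h1 : (z.snd : Unitization K B) = z := by
        ext
        · simp [h0]
        · simp
      refine ⟨z.snd, fun u a b ha hb => ?_, fun i a b ha hb => ?_⟩
      · refine (hy (some u) a b z.snd).trans ?_
        rw [h1]
        exact hz (some u) a b ha hb
      · simp only [LinearMap.comp_apply, Unitization.inrHom_apply, h1]
        exact hz' i a b ha hb
    mem_radical := fun z => by
      change (z : Unitization K B) ∈ Ring.jacobson (Unitization K B) ↔ _
      rw [P.mem_iff_diagCoord]
      refine ⟨fun h u a b ha hb => h (some u) a b ha hb, fun h o a b ha hb => ?_⟩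
      cases o with
      | none => rw [hcut]; simp
      | some u => exact h u a b ha hb
    ne_none := fun ⟨e, he⟩ i => C.ne_none_of_identity hP he i }⟩

end Unitization

end

theorem theorem6 {F : Type*} {K : Type u} {A : Type*} [Field F] [Infinite F] [Field K] [IsAlgClosed K]
    [Algebra F K] [NonUnitalRing A] [Module F A] [IsScalarTower F A A] [SMulCommClass F A A]
    (hA : ∃ s : Finset A, NonUnitalAlgebra.adjoin F (s : Set A) = ⊤)
    {N : ℕ} (ι : A →ₙₐ[F] Matrix (Fin N) (Fin N) K) (hι : Function.Injective ι) :
    ∃ (L : Type u) (_ : Field L) (_ : IsAlgClosed L) (_ : Algebra K L) (P : QuiverVertices)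
      (ρ : zariskiClosure (NonUnitalAlgHom.range ι) →ₙₐ[K] Matrix P.Idx P.Idx L),
      Function.Injective ρ ∧ IsWedderburnBlockForm P ρ ∧
        polynomialRelations (Set.range ρ) = Ideal.span {f | IsGluingRelation P ρ f} := by
  have : Infinite K := IsAlgClosed.instInfinite
  have : FiniteDimensional K (zariskiClosure (NonUnitalAlgHom.range ι)) :=
    inferInstanceAs (FiniteDimensional K (zariskiClosure (NonUnitalAlgHom.range ι)).toSubmodule)
  obtain ⟨C⟩ := exists_blockCoordinates K (zariskiClosure (NonUnitalAlgHom.range ι))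
  exact ⟨K, inferInstance, inferInstance, inferInstance, C.exists_representation⟩
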